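/- Let $G_B=([m],[n],E_B)$ be a bipartite graph in which every left vertex $i\in[m]$ has a nonempty set of neighbours $\mathcal N(i)\subseteq[n]$, and let $\vec r=(r_1,\dots,r_m)\in(0,1]^m$ be rational. Let $G_D$ be the dependency graph of $G_B$: the graph on $[m]$ in which $i\ne k$ are adjacent iff $\mathcal N(i)\cap\mathcal N(k)\neq\emptyset$. Put $I(G_B,\vec r)=\sum_{S}(-1)^{|S|}\prod_{i\in S}r_i$, the sum being over the independent sets $S$ of $G_D$. Let $\mathcal I(G_B)$ be the set of vectors $\vec p$ such that $\Pr(\bigcap_i\overline{A_i})>0$ for all events $A_1,\dots,A_m$ (on any probability space) with $\Pr(A_i)=p_i$ for which $G_D$ is a dependency graph, i.e. each $A_i$ is independent of the family $\{A_k: k\ne i,\ k \text{ not adjacent to } i\}$. Say that $\vec r$ is beyond Shearer's bound if $I(G_B(S),\vec r)\le 0$ for some $S\subseteq[m]$, where $G_B(S)$ is the induced subgraph of $G_B$ on the left vertices in $S$ and the right vertices in $[n]$; otherwise $\vec r$ is in Shearer's bound. For positive integers $\vec d=(d_1,\dots,d_n)$ let $\mathcal H_j=\mathbb C^{d_j}$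 and $\mathcal H_S=\bigotimes_{j\in S}\mathcal H_j$. The relative dimension of a subspace $V$ of $\mathcal H$ is $R(V)=\dim V/\dim\mathcal H$. A random instance of the setting $(G_B,\vec r,\vec d)$ is a family $V_i=V_i^{loc}\otimes\mathcal H_{[n]\setminus\mathcal N(i)}$, $i\in[m]$, of subspaces of $\mathcal H_{[n]}$, where the $V_i^{loc}$ are independent Haar-random subspaces of $\mathcal H_{\mathcal N(i)}$ of relative dimension $r_i$ (in particular $r_i\dim\mathcal H_{\mathcal N(i)}$ must be an integer). Let $\mathrm{pd}(r)$ be the denominator of $r$ in lowest terms. Then $\vec r\in\mathcal I(G_B)$ if and only if $\vec r$ is in Shearer's bound, and: (a) If $\vec r\notin\mathcal I(G_B)$, there are positive integers $d_1,\dots,d_n\le\prod_{i=1}^m\mathrm{pd}(r_i)^{2^{2m}}$ such that for a random instance of the setting $(G_B,\vec r,\vec d)$ one has $R(V_1+\dots+V_m)=1$ with probability $1$. (b) If $\vec r\in\mathcal I(G_B)$, there are positive integers $d_1,\dots,d_n\le\prod_{i=1}^m\mathrm{pd}(r_i)^{2^{2m+3}}$ such that for a random instance of the setting $(G_B,\vec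 r,\vec d)$ one has $R(V_1+\dots+V_m)=1-I(G_B,\vec r)$ with probability $1$. -/

import Mathlib

open MeasureTheory Module

/-! ### Graphs, independence polynomial, Shearer's bound, abstract interior -/

/-- A bipartite graph with left vertices `V` and right vertices `Q` is given by the neighbourhoods
`N i ⊆ Q` of its left vertices. Its dependency graph joins two distinct left vertices iff they
share a neighbour. -/
def depGraph {V Q : Type*} [DecidableEq Q] (N : V → Finset Q) : SimpleGraph V where
  Adj i k := i ≠ k ∧ (N i ∩ N k).Nonempty
  symm := ⟨fun i k h => ⟨h.1.symm, by rw [Finset.inter_comm]; exact h.2⟩⟩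
  loopless := ⟨fun _ h => h.1 rfl⟩

open scoped Classical in
/-- The multivariate independence polynomial
`I(G, x) = ∑_{S independent} (-1)^{|S|} ∏_{v ∈ S} x_v`. -/
noncomputable def indepPoly {V R : Type*} [Fintype V] [CommRing R] (G : SimpleGraph V)
    (x : V → R) : R :=
  ∑ S ∈ Finset.univ.filter (fun S : Finset V => G.IsIndepSet (S : Set V)),
    (-1) ^ S.card * ∏ v ∈ S, x v

/-- `x` is beyond Shearer's bound for `G`: the independence polynomial of some induced subgraph is
nonpositive at (the restriction of) `x`. Otherwise `x` is in Shearer's bound. -/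
def BeyondShearer {V R : Type*} [CommRing R] [LinearOrder R] (G : SimpleGraph V)
    (x : V → R) : Prop :=
  ∃ S : Finset V, indepPoly (G.induce (S : Set V)) (fun v => x v) ≤ 0

/-- `G` is a dependency graph of the events `A`: each `A i` is independent of the family of all
events `A k` with `k ≠ i` not adjacent to `i`. -/
def IsDependencyGraph {V Ω : Type*} [MeasurableSpace Ω] (P : Measure Ω) (G : SimpleGraph V)
    (A : V → Set Ω) : Prop :=
  ∀ i, ProbabilityTheory.Indep (MeasurableSpace.generateFrom {A i})
    (MeasurableSpace.generateFrom {B | ∃ k, k ≠ i ∧ ¬ G.Adj i k ∧ B = A k}) P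

/-- The abstract interior of `G`: the vectors `p` such that any events with dependency graph `G`
and probabilities `p` can be avoided simultaneously with positive probability. -/
def abstractInterior {V : Type*} (G : SimpleGraph V) : Set (V → ℝ) :=
  {p | ∀ (Ω : Type) [MeasurableSpace Ω] (P : Measure Ω) [IsProbabilityMeasure P]
    (A : V → Set Ω), (∀ i, MeasurableSet (A i)) → IsDependencyGraph P G A →
    (∀ i, P (A i) = ENNReal.ofReal (p i)) → 0 < P (⋂ i, (A i)ᶜ)}

/-! ### Qudits, local subspaces, relative dimension -/

/-- The computational basis of the qudits in `S`, where qudit `j` has dimension `d j`. -/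
abbrev Config {Q : Type*} (d : Q → ℕ) (S : Finset Q) : Type _ := ∀ j : S, Fin (d j)

/-- The space `⨂_{j ∈ S} ℂ^{d j}` of the qudits in `S`, written in the computational basis. -/
abbrev QuditSpace {Q : Type*} (d : Q → ℕ) (S : Finset Q) : Type _ := Config d S → ℂ

/-- The space `⨂_j ℂ^{d j}` of all qudits, written in the computational basis. -/
abbrev TotalSpace {Q : Type*} (d : Q → ℕ) : Type _ := (∀ j, Fin (d j)) → ℂ

/-- For `L ⊆ ⨂_{j ∈ S} ℂ^{d j}`, the subspace `L ⊗ ⨂_{j ∉ S} ℂ^{d j}` of the total space, spanned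
by the product vectors `v ⊗ w` with `v ∈ L`. -/
noncomputable def tensorRest {Q : Type*} [Fintype Q] [DecidableEq Q] (d : Q → ℕ) (S : Finset Q)
    (L : Submodule ℂ (QuditSpace d S)) : Submodule ℂ (TotalSpace d) :=
  Submodule.span ℂ {f | ∃ v ∈ L, ∃ w : QuditSpace d Sᶜ,
    f = fun x => v (S.restrict x) * w (Sᶜ.restrict x)}

/-- The relative dimension `dim W / dim H` of a subspace `W` of `H`. -/
noncomputable def relDim {H : Type*} [AddCommGroup H] [Module ℂ H] (W : Submodule ℂ H) : ℚ :=
  (finrank ℂ W : ℚ) / (finrank ℂ H : ℚ)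

/-! ### Haar measure on the unitary group and random subspaces -/

noncomputable instance unitaryGroupMeasurableSpace (ι : Type*) [Fintype ι] [DecidableEq ι] :
    MeasurableSpace (Matrix.unitaryGroup ι ℂ) := borel _

instance unitaryGroupBorelSpace (ι : Type*) [Fintype ι] [DecidableEq ι] :
    BorelSpace (Matrix.unitaryGroup ι ℂ) := ⟨rfl⟩

instance unitaryGroupCompactSpace (ι : Type*) [Fintype ι] [DecidableEq ι] :
    CompactSpace (Matrix.unitaryGroup ι ℂ) := by
  apply isCompact_iff_compactSpace.mp
  have h1 : IsCompact {M : Matrix ι ι ℂ | ∀ i, M i ∈ {f : ι → ℂ | ∀ j, f j ∈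
      Metric.closedBall (0 : ℂ) 1}} :=
    isCompact_pi_infinite fun _ => isCompact_pi_infinite fun _ => isCompact_closedBall 0 1
  refine h1.of_isClosed_subset isClosed_unitary ?_
  intro U hU i j
  rw [mem_closedBall_zero_iff]
  exact entry_norm_bound_of_unitary hU i j

/-- The Haar probability measure on the unitary group. -/
noncomputable def unitaryHaar (ι : Type*) [Fintype ι] [DecidableEq ι] :
    Measure (Matrix.unitaryGroup ι ℂ) :=
  Measure.haarMeasure ⊤

instance unitaryHaarIsProbability (ι : Type*) [Fintype ι] [DecidableEq ι] :
    IsProbabilityMeasure (unitaryHaar ι) :=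
  ⟨by simpa [unitaryHaar] using
    Measure.haarMeasure_self (K₀ := (⊤ : TopologicalSpace.PositiveCompacts
      (Matrix.unitaryGroup ι ℂ)))⟩

/-- The subspaces `V_i = (U_i W_i) ⊗ H_{[n] ∖ N i}` of the total space, for reference subspaces
`W_i` and unitaries `U_i` of the spaces of the qudits in `N i`. -/
noncomputable def rotated {V Q : Type*} [Fintype Q] [DecidableEq Q] (N : V → Finset Q) (d : Q → ℕ)
    (W : ∀ i, Submodule ℂ (QuditSpace d (N i)))
    (U : ∀ i, Matrix.unitaryGroup (Config d (N i)) ℂ) (i : V) : Submodule ℂ (TotalSpace d) :=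
  tensorRest d (N i) ((W i).map (Matrix.mulVecLin (U i : Matrix _ _ ℂ)))

/-- The property `E` holds with probability one for a random instance of the setting `(N, r, d)`.
A Haar random subspace of relative dimension `r i` of the space of the qudits in `N i` is `U_i W_i`
with `U_i` a Haar random unitary and `W_i` any fixed subspace of that relative dimension (the law
does not depend on `W_i`); the `U_i` are independent. Such subspaces are required to exist. -/
def AlmostSurelyForRandomInstance {V Q : Type*} [Fintype V] [Fintype Q] [DecidableEq Q]
    (N : V → Finset Q) (r : V → ℚ) (d : Q → ℕ)
    (E : (V → Submodule ℂ (TotalSpace d)) → Prop) : Prop :=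
  (∃ W : ∀ i, Submodule ℂ (QuditSpace d (N i)), ∀ i, relDim (W i) = r i) ∧
  ∀ W : ∀ i, Submodule ℂ (QuditSpace d (N i)), (∀ i, relDim (W i) = r i) →
    ∀ᵐ U ∂(Measure.pi fun i => unitaryHaar (Config d (N i))), E (rotated N d W U)

/-! ### Zero sets of polynomials on products of unitary groups -/

/-! Write I(T) for the independence polynomial of the subgraph induced on T. One recursion drives
everything: I(T + v) = I(T) - r_v I(T minus the neighbours of v). Any Q with Q(∅) = 1 that satisfies
this with ≥ dominates I as long as all I(T) are positive (`shearer_ratio_bound`). For Q the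
probability of avoiding the events in T, this is the easy half of Shearer's theorem. For Q(T) = 1 -
R(∑_{i ∈ T} V_i), it is the upper bound R ≤ 1 - I, valid for every choice of subspaces
(`relDim_iSup_le_one_sub`). The other half of Shearer's theorem comes from a random independent set
at a point where some I(S) vanishes, with independent coins raising the probabilities to r.

For the lower bound on R a single good instance is enough. The rank of the sum is governed by minors
that are polynomial in the unitaries, and a polynomial that is nonzero at one tuple of unitaries is
nonzero almost everywhere (`ae_unitary_det_ne_zero`), so a random instance does at least as well
(`Achieves.ae`).

The good instance is built by recursion on S (`Achieves.split_clique`, `achieves_step`). Fix a qudit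
j; the vertices of S touching j form a clique K. Enlarge j by a factor M and let the new factor
label M blocks. A block is either given to one i ∈ K, which spends r'_i = I(S \ K) / I(P_i) there
while the rest of K spends nothing, P_i being the non-neighbours of i in S; or it is left over, and
all of K spends nothing. The value r'_i is the root of I(S \ K + i), so by recursion the block is
filled. Since i can afford a fraction r_i / r'_i of the blocks, the fraction left over is max(0,
I(S) / I(S \ K)): zero beyond Shearer's bound, while inside it, filling these blocks up to 1 - I(S \
K) gives 1 - I(S) in total. A vertex that does not touch j must use the same subspace in all blocks;
a common generic subspace is good for all of them at once (`exists_common_local`). Counting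
denominators along the recursion bounds the dimensions. -/

theorem ae_ne_zero_of_oneParameter {G : Type*} [Group G] [TopologicalSpace G]
    [IsTopologicalGroup G] [SecondCountableTopology G] [MeasurableSpace G] [BorelSpace G]
    (μ : Measure G) [μ.IsMulLeftInvariant] [μ.IsOpenPosMeasure] [IsFiniteMeasure μ]
    {f : G → ℂ} (hf : Continuous f) {g₀ : G} (h₀ : f g₀ ≠ 0)
    (hφ : ∀ h : G, ∃ φ : ℝ → G, Continuous φ ∧ φ 1 = h ∧ (∀ s t, φ (s + t) = φ s * φ t) ∧
      ∀ g, AnalyticOnNhd ℝ (fun s => f (φ s * g)) Set.univ) :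
    ∀ᵐ g ∂μ, f g ≠ 0 := by
  have key : ∀ h : G, ∀ᵐ g ∂μ, f g = 0 → f (h * g) = 0 := by
    intro h
    obtain ⟨φ, hc, h1, hadd, han⟩ := hφ h
    have hφ0 : φ 0 = 1 := by simpa using hadd 0 0
    -- Zeros of `f` whose orbit under the subgroup leaves the zero set. By analyticity each orbit
    -- meets `N` at a Lebesgue-null set of times, so Fubini and invariance of `μ` make `N` null.
    set N : Set G := {g | f g = 0 ∧ ∃ s, f (φ s * g) ≠ 0} with hN
    have hopen : IsOpen {g | ∃ s, f (φ s * g) ≠ 0} := by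
      rw [Set.ofPred_exists]
      refine isOpen_iUnion fun s => ?_
      exact isOpen_ne.preimage (hf.comp (continuous_const.mul continuous_id))
    have hNm : MeasurableSet N :=
      ((isClosed_singleton.preimage hf).measurableSet).inter hopen.measurableSet
    have hinv : ∀ s g, φ s * g ∈ N ↔ (f (φ s * g) = 0 ∧ ∃ t, f (φ t * g) ≠ 0) := by
      intro s g
      simp only [hN, Set.mem_ofPred_eq, ← mul_assoc, ← hadd]
      refine and_congr_right fun _ => ⟨fun ⟨t, ht⟩ => ⟨_, ht⟩, fun ⟨t, ht⟩ => ⟨t - s, ?_⟩⟩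
      simpa using ht
    have hcontmul : Continuous fun p : ℝ × G => φ p.1 * p.2 := by fun_prop
    have hmeas : MeasurableSet {p : ℝ × G | ¬ (φ p.1 * p.2 ∈ N)} :=
      (hcontmul.measurable hNm).compl
    have h2 : ∀ᵐ g ∂μ, ∀ᵐ s : ℝ, ¬ (φ s * g ∈ N) := by
      refine Filter.Eventually.of_forall fun g => ?_
      by_cases hg : ∃ t, f (φ t * g) ≠ 0
      · obtain ⟨t, ht⟩ := hg
        have := (han g).preimage_zero_mem_codiscrete (x := t) ht
        have h3 := ae_restrict_le_codiscreteWithin (μ := (volume : Measure ℝ))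
          MeasurableSet.univ this
        rw [Measure.restrict_univ] at h3
        filter_upwards [h3] with s hs
        rw [hinv]
        exact fun h => hs h.1
      · exact Filter.Eventually.of_forall fun s => by rw [hinv]; exact fun h => hg h.2
    have h3 : ∀ᵐ s : ℝ, ∀ᵐ g ∂μ, ¬ (φ s * g ∈ N) :=
      (Measure.ae_ae_comm (p := fun (s : ℝ) (g : G) => ¬ (φ s * g ∈ N)) hmeas).2 h2
    obtain ⟨s, hs⟩ := h3.exists
    have h4 : μ N = 0 := by
      rw [← measure_preimage_mul μ (φ s) N]
      exact (by simpa [ae_iff] using hs : μ {a | φ s * a ∈ N} = 0)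
    have h5 : ∀ᵐ g ∂μ, g ∉ N := by simpa [ae_iff] using h4
    filter_upwards [h5] with g hg h0
    by_contra hne
    exact hg ⟨h0, 1, by rwa [h1]⟩
  have hmeas : MeasurableSet {p : G × G | f p.2 = 0 → f (p.1 * p.2) = 0} := by
    have hA : MeasurableSet {p : G × G | f p.2 = 0} :=
      (isClosed_singleton.preimage (hf.comp continuous_snd)).measurableSet
    have hB : MeasurableSet {p : G × G | f (p.1 * p.2) = 0} :=
      (isClosed_singleton.preimage (hf.comp continuous_mul)).measurableSet
    exact hA.imp hB
  have h2 : ∀ᵐ g ∂μ, ∀ᵐ h ∂μ, f g = 0 → f (h * g) = 0 :=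
    (Measure.ae_ae_comm (p := fun (h g : G) => f g = 0 → f (h * g) = 0) hmeas).1
      (Filter.Eventually.of_forall key)
  filter_upwards [h2] with g hg h0
  -- This open set contains `g₀ * g⁻¹`, hence has positive measure, whereas a typical zero `g` would
  -- make it null.
  have hO : IsOpen {h : G | f (h * g) ≠ 0} :=
    isOpen_ne.preimage (hf.comp (continuous_id.mul continuous_const))
  refine (hO.measure_pos μ ⟨g₀ * g⁻¹, by simpa using h₀⟩).ne' ?_
  have := (hg.mono fun h hh => hh h0)
  simpa [ae_iff] using this

/-- Every function is continuous on a finite set, so the principal argument can be fed to the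
functional calculus even if the spectrum meets the branch cut. -/
theorem expUnitary_argSelfAdjoint_of_finite_spectrum {A : Type*} [CStarAlgebra A] (u : unitary A)
    (hu : (spectrum ℂ (u : A)).Finite) :
    selfAdjoint.expUnitary (Unitary.argSelfAdjoint u) = u := by
  ext
  have : ContinuousOn Complex.arg (spectrum ℂ (u : A)) := hu.continuousOn _
  rw [selfAdjoint.expUnitary_coe, Unitary.argSelfAdjoint_coe,
    ← CFC.exp_eq_normedSpace_exp (𝕜 := ℂ), ← cfc_comp_smul .., ← cfc_comp' ..]
  conv_rhs => rw [← cfc_id' ℂ (u : A)]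
  refine cfc_congr fun y hy ↦ ?_
  have hy₁ : ‖y‖ = 1 := spectrum.norm_eq_one_of_unitary u.2 hy
  have h0 : y ≠ 0 := by rintro rfl; simp at hy₁
  have : Complex.I * y.arg = Complex.log y :=
    Complex.ext (by simp [Complex.log_re, hy₁]) (by simp [Complex.log_im])
  simpa [← Complex.exp_eq_exp_ℂ, this] using Complex.exp_log h0

-- The spectrum of a matrix is finite, so `u` is exp(ix) with x self-adjoint, and s ↦ exp(isx) is
-- the required subgroup.
open scoped Matrix.Norms.L2Operator in
theorem exists_oneParameter_unitary {ι : Type*} [Fintype ι] [DecidableEq ι]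
    (u : Matrix.unitaryGroup ι ℂ) :
    ∃ φ : ℝ → Matrix.unitaryGroup ι ℂ, Continuous φ ∧ φ 1 = u ∧
      (∀ s t, φ (s + t) = φ s * φ t) ∧
      ∀ a b, AnalyticOnNhd ℝ (fun s => (φ s : Matrix ι ι ℂ) a b) Set.univ := by
  let x : selfAdjoint (Matrix ι ι ℂ) := Unitary.argSelfAdjoint u
  have hx : selfAdjoint.expUnitary x = u :=
    expUnitary_argSelfAdjoint_of_finite_spectrum u (Matrix.finite_spectrum (u : Matrix ι ι ℂ))
  refine ⟨fun s => selfAdjoint.expUnitary (s • x), by fun_prop, by simpa using hx, ?_, ?_⟩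
  · intro s t
    beta_reduce
    rw [add_smul]
    refine Commute.expUnitary_add ?_
    simp only [selfAdjoint.val_smul]
    exact ((Commute.refl _).smul_left s).smul_right t
  · intro a b s _
    have h1 : AnalyticAt ℝ (fun s : ℝ => NormedSpace.exp ((Complex.I • s • (x : Matrix ι ι ℂ)))) s := by
      have h2 : AnalyticAt ℝ (fun s : ℝ => (Complex.I • s • (x : Matrix ι ι ℂ))) s := by
        have := ((ContinuousLinearMap.toSpanSingleton ℝ (Complex.I • (x : Matrix ι ι ℂ))).analyticAt s)
        refine this.congr (Filter.Eventually.of_forall fun t => ?_)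
        exact smul_comm t Complex.I (x : Matrix ι ι ℂ)
      exact (NormedSpace.exp_analytic (𝕂 := ℝ) _).comp h2
    let e : Matrix ι ι ℂ →ₗ[ℝ] ℂ :=
      { toFun := fun M => M a b, map_add' := fun _ _ => rfl, map_smul' := fun _ _ => rfl }
    exact (e.toContinuousLinearMap.analyticAt _).comp h1

instance (ι : Type*) [Fintype ι] [DecidableEq ι] :
    SecondCountableTopology (Matrix.unitaryGroup ι ℂ) := by
  have : SecondCountableTopology (Matrix ι ι ℂ) :=
    inferInstanceAs (SecondCountableTopology (ι → ι → ℂ))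
  exact TopologicalSpace.Subtype.secondCountableTopology _

instance (ι : Type*) [Fintype ι] [DecidableEq ι] : (unitaryHaar ι).IsHaarMeasure := by
  unfold unitaryHaar; infer_instance

theorem ae_unitary_det_ne_zero {V : Type*} [Fintype V] {ι : V → Type*} [∀ i, Fintype (ι i)]
    [∀ i, DecidableEq (ι i)] {k : ℕ}
    (B : (∀ i, Matrix (ι i) (ι i) ℂ) →ₗ[ℂ] Matrix (Fin k) (Fin k) ℂ)
    (U₀ : ∀ i, Matrix.unitaryGroup (ι i) ℂ) (h₀ : (B fun i => U₀ i).det ≠ 0) :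
    ∀ᵐ U : (∀ i, Matrix.unitaryGroup (ι i) ℂ) ∂(Measure.pi fun i => unitaryHaar (ι i)),
      (B fun i => U i).det ≠ 0 := by
  have hBc : Continuous B := by
    have : ∀ i, FiniteDimensional ℂ (Matrix (ι i) (ι i) ℂ) := fun i => inferInstance
    exact LinearMap.continuous_of_finiteDimensional B
  refine ae_ne_zero_of_oneParameter (Measure.pi fun i => unitaryHaar (ι i))
    (f := fun U => (B fun i => U i).det) (g₀ := U₀) ?_ h₀ ?_
  · refine Continuous.matrix_det (hBc.comp ?_)
    fun_prop
  · intro h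
    choose φ hc h1 hadd han using fun i => exists_oneParameter_unitary (h i)
    refine ⟨fun s i => φ i s, by fun_prop, funext h1, fun s t => funext fun i => hadd i s t, ?_⟩
    intro g
    have hent : ∀ a b, AnalyticOnNhd ℝ (fun s => (B fun i => (φ i s * g i : Matrix (ι i) (ι i) ℂ)) a b)
        Set.univ := by
      intro a b
      classical
      -- Expanding `B` in matrix units reduces analyticity of its entries to that of the entries of
      -- the one-parameter subgroups.
      have hB : ∀ M : (∀ i, Matrix (ι i) (ι i) ℂ), B M a b =
          ∑ i, ∑ x, ∑ y, M i x y * B (Pi.single i (Matrix.single x y 1)) a b := by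
        intro M
        have : M = ∑ i, ∑ x, ∑ y, M i x y • Pi.single i (Matrix.single x y (1 : ℂ)) := by
          conv_lhs => rw [← Finset.univ_sum_single M]
          refine Finset.sum_congr rfl fun i _ => ?_
          rw [← LinearMap.coe_single ℂ (fun i => Matrix (ι i) (ι i) ℂ) i]
          conv_lhs => rw [Matrix.matrix_eq_sum_single (M i), map_sum]
          refine Finset.sum_congr rfl fun x _ => ?_
          rw [map_sum]
          refine Finset.sum_congr rfl fun y _ => ?_
          rw [← map_smul, Matrix.smul_single, smul_eq_mul, mul_one]
        conv_lhs => rw [this]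
        simp only [map_sum, map_smul, Matrix.sum_apply, Matrix.smul_apply, smul_eq_mul]
      rw [funext fun s => hB fun i => (φ i s * g i : Matrix (ι i) (ι i) ℂ)]
      refine Finset.analyticOnNhd_fun_sum _ fun i _ => Finset.analyticOnNhd_fun_sum _ fun x _ =>
        Finset.analyticOnNhd_fun_sum _ fun y _ => AnalyticOnNhd.mul ?_ analyticOnNhd_const
      simp only [Matrix.mul_apply]
      exact Finset.analyticOnNhd_fun_sum _ fun z _ => (han i x z).mul analyticOnNhd_const
    have : (fun s => (B fun i => (((fun i => φ i s) * g : ∀ i, Matrix.unitaryGroup (ι i) ℂ) i :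
        Matrix (ι i) (ι i) ℂ)).det) = fun s => ∑ σ : Equiv.Perm (Fin k), (Equiv.Perm.sign σ : ℂ) *
          ∏ a, (B fun i => (φ i s * g i : Matrix (ι i) (ι i) ℂ)) (σ a) a := by
      funext s
      rw [Matrix.det_apply']
      rfl
    rw [this]
    refine Finset.analyticOnNhd_fun_sum _ fun σ _ => analyticOnNhd_const.mul ?_
    exact Finset.analyticOnNhd_fun_prod _ fun a _ => hent _ _

/-! ### The independence polynomial as a function of the vertex set -/

section IndependencePolynomial

variable {V R : Type*} [DecidableEq V] [CommRing R]

open scoped Classical in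
/-- The independence polynomial of the subgraph of `G` induced on `T`. -/
noncomputable def indepPolyOn (G : SimpleGraph V) (r : V → R) (T : Finset V) : R :=
  ∑ S ∈ T.powerset, if G.IsIndepSet (S : Set V) then (-1) ^ S.card * ∏ v ∈ S, r v else 0

open scoped Classical in
/-- The vertices of `T` that are not adjacent to `v`. -/
noncomputable def nonNbrs {V : Type*} (G : SimpleGraph V) (v : V) (T : Finset V) : Finset V :=
  T.filter fun w => ¬ G.Adj v w

@[simp] theorem mem_nonNbrs {V : Type*} {G : SimpleGraph V} {v w : V} {T : Finset V} :
    w ∈ nonNbrs G v T ↔ w ∈ T ∧ ¬ G.Adj v w := by simp [nonNbrs]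

theorem nonNbrs_subset {V : Type*} (G : SimpleGraph V) (v : V) (T : Finset V) : nonNbrs G v T ⊆ T :=
  fun _ h => (mem_nonNbrs.1 h).1

@[simp] theorem indepPolyOn_empty (G : SimpleGraph V) (r : V → R) : indepPolyOn G r ∅ = 1 := by
  simp [indepPolyOn, SimpleGraph.isIndepSet_iff]

theorem isIndepSet_insert_iff {G : SimpleGraph V} {v : V} {S : Finset V} (hv : v ∉ S) :
    G.IsIndepSet ((insert v S : Finset V) : Set V) ↔
      G.IsIndepSet (S : Set V) ∧ ∀ w ∈ S, ¬ G.Adj v w := by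
  rw [SimpleGraph.isIndepSet_iff, SimpleGraph.isIndepSet_iff, Finset.coe_insert,
    Set.pairwise_insert_of_notMem (by simpa using hv)]
  refine and_congr_right fun _ => forall₂_congr fun w _ => ?_
  rw [G.adj_comm w v]; exact and_self_iff

/-- An independent set containing `v` is `v` together with an independent set of non-neighbours of
`v`. -/
theorem indepPolyOn_insert (G : SimpleGraph V) (r : V → R) {v : V} {T : Finset V} (hv : v ∉ T) :
    indepPolyOn G r (insert v T) =
      indepPolyOn G r T - r v * indepPolyOn G r (nonNbrs G v T) := by
  classical
  unfold indepPolyOn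
  rw [Finset.sum_powerset_insert hv, sub_eq_add_neg, add_right_inj, Finset.mul_sum,
    ← Finset.sum_neg_distrib]
  symm
  refine Finset.sum_subset_zero_on_sdiff
    (Finset.powerset_mono.2 (nonNbrs_subset G v T)) ?_ ?_
  · intro S hS
    simp only [Finset.mem_sdiff, Finset.mem_powerset] at hS
    have hvS : v ∉ S := fun h => hv (hS.1 h)
    rw [if_neg]
    rw [isIndepSet_insert_iff hvS]
    rintro ⟨-, h⟩
    exact hS.2 fun w hw => mem_nonNbrs.2 ⟨hS.1 hw, h w hw⟩
  · intro S hS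
    rw [Finset.mem_powerset] at hS
    have hvS : v ∉ S := fun h => hv (nonNbrs_subset G v T (hS h))
    have : G.IsIndepSet ((insert v S : Finset V) : Set V) ↔ G.IsIndepSet (S : Set V) := by
      rw [isIndepSet_insert_iff hvS]
      exact and_iff_left fun w hw => (mem_nonNbrs.1 (hS hw)).2
    simp only [this]
    split_ifs
    · rw [Finset.card_insert_of_notMem hvS, Finset.prod_insert hvS]; ring
    · simp

theorem indepPolyOn_eq_sub (G : SimpleGraph V) (r : V → R) {v : V} {T : Finset V} (hv : v ∈ T) :
    indepPolyOn G r T =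
      indepPolyOn G r (T.erase v) - r v * indepPolyOn G r (nonNbrs G v (T.erase v)) := by
  conv_lhs => rw [← Finset.insert_erase hv]
  exact indepPolyOn_insert G r (Finset.notMem_erase v T)

theorem indepPolyOn_congr (G : SimpleGraph V) {r r' : V → R} {T : Finset V}
    (h : ∀ v ∈ T, r v = r' v) : indepPolyOn G r T = indepPolyOn G r' T := by
  unfold indepPolyOn
  refine Finset.sum_congr rfl fun S hS => ?_
  rw [Finset.prod_congr rfl fun v hv => h v (Finset.mem_powerset.1 hS hv)]

theorem indepPolyOn_inter (G : SimpleGraph V) {r : V → R} {S : Finset V}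
    (h : ∀ v, v ∉ S → r v = 0) (T : Finset V) :
    indepPolyOn G r T = indepPolyOn G r (T ∩ S) := by
  classical
  unfold indepPolyOn
  symm
  refine Finset.sum_subset (Finset.powerset_mono.2 Finset.inter_subset_left) fun A hA hA' => ?_
  simp only [Finset.mem_powerset] at hA hA'
  obtain ⟨v, hv, hvS⟩ : ∃ v ∈ A, v ∉ S := by
    by_contra! hcon
    exact hA' fun v hv => Finset.mem_inter.2 ⟨hA hv, hcon v hv⟩
  rw [Finset.prod_eq_zero hv (h v hvS)]
  simp

theorem map_indepPolyOn {R' : Type*} [CommRing R'] (f : R →+* R') (G : SimpleGraph V) (r : V → R)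
    (T : Finset V) : f (indepPolyOn G r T) = indepPolyOn G (fun v => f (r v)) T := by
  classical
  unfold indepPolyOn
  rw [map_sum]
  refine Finset.sum_congr rfl fun S _ => ?_
  split_ifs <;> simp

theorem indepPoly_eq_indepPolyOn [Fintype V] (G : SimpleGraph V) (r : V → R) :
    indepPoly G r = indepPolyOn G r Finset.univ := by
  classical
  unfold indepPoly indepPolyOn
  rw [Finset.sum_filter, Finset.powerset_univ]
  exact Finset.sum_congr rfl fun S _ => by congr

theorem indepPoly_induce (G : SimpleGraph V) (r : V → R) (S : Finset V) :
    indepPoly (G.induce (S : Set V)) (fun v => r v) = indepPolyOn G r S := by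
  classical
  unfold indepPoly indepPolyOn
  rw [Finset.sum_filter]
  refine Finset.sum_bij (fun A _ => A.map (Function.Embedding.subtype _)) ?_ ?_ ?_ ?_
  · intro A _
    rw [Finset.mem_powerset]
    intro v hv
    obtain ⟨w, -, rfl⟩ := Finset.mem_map.1 hv
    exact w.2
  · intro A _ B _ h
    exact Finset.map_injective _ h
  · intro B hB
    rw [Finset.mem_powerset] at hB
    refine ⟨B.subtype (· ∈ (S : Set V)), Finset.mem_univ _, ?_⟩
    rw [Finset.subtype_map, Finset.filter_true_of_mem]
    exact fun v hv => hB hv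
  · intro A _
    have : (G.induce (S : Set V)).IsIndepSet (A : Set (S : Set V)) ↔
        G.IsIndepSet ((A.map (Function.Embedding.subtype _) : Finset V) : Set V) := by
      rw [SimpleGraph.isIndepSet_iff, SimpleGraph.isIndepSet_iff, Finset.coe_map,
        Set.InjOn.pairwise_image (Function.Embedding.injective _).injOn]
      rfl
    simp only [this, Finset.card_map, Finset.prod_map, Function.Embedding.subtype_apply]

theorem not_beyondShearer_iff [LinearOrder R] (G : SimpleGraph V) (r : V → R) :
    ¬ BeyondShearer G r ↔ ∀ T, 0 < indepPolyOn G r T := by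
  simp only [BeyondShearer, not_exists, not_le, indepPoly_induce]

end IndependencePolynomial

/-! ### Shearer's ratio inequality and the weights of the extremal measure -/

section Shearer

variable {V R : Type*} [DecidableEq V] [Field R] [LinearOrder R] [IsStrictOrderedRing R]

theorem nonNbrs_erase_ssubset (G : SimpleGraph V) {v : V} {T : Finset V} (hv : v ∈ T) :
    nonNbrs G v (T.erase v) ⊂ T :=
  (nonNbrs_subset G v _).trans_ssubset (Finset.erase_ssubset hv)

theorem indepPolyOn_le_of_subset (G : SimpleGraph V) {r : V → R} {T : Finset V}
    (hr : ∀ v ∈ T, 0 ≤ r v) (hT : ∀ A, A ⊂ T → 0 < indepPolyOn G r A) {A : Finset V} (hA : A ⊆ T) :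
    indepPolyOn G r T ≤ indepPolyOn G r A := by
  induction T using Finset.strongInduction with
  | H T ih =>
    by_cases hAT : A = T
    · rw [hAT]
    obtain ⟨v, hvT, hvA⟩ := Finset.exists_of_ssubset (hA.ssubset_of_ne hAT)
    rw [indepPolyOn_eq_sub G r hvT]
    have h1 := ih (T.erase v) (Finset.erase_ssubset hvT)
      (fun w hw => hr w (Finset.mem_of_mem_erase hw))
      (fun B hB => hT B (hB.trans (Finset.erase_ssubset hvT)))
      (Finset.subset_erase.2 ⟨hA, hvA⟩)
    have h2 := mul_nonneg (hr v hvT) (hT _ (nonNbrs_erase_ssubset G hvT)).le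
    linarith

theorem indepPolyOn_le_one (G : SimpleGraph V) {r : V → R} {T : Finset V}
    (hr : ∀ v ∈ T, 0 ≤ r v) (hT : ∀ A, A ⊂ T → 0 < indepPolyOn G r A) :
    indepPolyOn G r T ≤ 1 := by
  simpa using indepPolyOn_le_of_subset G hr hT (Finset.empty_subset T)

/-- The quotient Q / I is nondecreasing in the set, stated without division. Removing one vertex
compares the recursions for Q and I, with the induction hypothesis controlling the ratio at the
non-neighbours; larger removals compose such steps. -/
theorem shearer_ratio_bound (G : SimpleGraph V) {r : V → R} (hr : ∀ v, 0 ≤ r v)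
    (hI : ∀ T, 0 < indepPolyOn G r T) {Q : Finset V → R} (hQ0 : Q ∅ = 1)
    (hQ : ∀ v T, v ∉ T → Q T - r v * Q (nonNbrs G v T) ≤ Q (insert v T)) (T : Finset V) :
    0 < Q T ∧ ∀ A ⊆ T, indepPolyOn G r T * Q A ≤ Q T * indepPolyOn G r A := by
  induction T using Finset.strongInduction with
  | H T ih =>
    have step : ∀ v ∈ T, indepPolyOn G r T * Q (T.erase v) ≤ Q T * indepPolyOn G r (T.erase v) := by
      intro v hv
      have h1 := hQ v (T.erase v) (Finset.notMem_erase v T)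
      rw [Finset.insert_erase hv] at h1
      have h2 := (ih _ (Finset.erase_ssubset hv)).2 _ (nonNbrs_subset G v (T.erase v))
      rw [indepPolyOn_eq_sub G r hv]
      have h3 := mul_le_mul_of_nonneg_left h2 (hr v)
      have h4 := mul_le_mul_of_nonneg_right h1 (hI (T.erase v)).le
      linarith
    have hpos : 0 < Q T := by
      rcases T.eq_empty_or_nonempty with rfl | ⟨v, hv⟩
      · rw [hQ0]; exact one_pos
      · have h1 := (ih _ (Finset.erase_ssubset hv)).1
        exact pos_of_mul_pos_left ((mul_pos (hI T) h1).trans_le (step v hv)) (hI _).le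
    refine ⟨hpos, fun A hA => ?_⟩
    by_cases hAT : A = T
    · rw [hAT, mul_comm]
    obtain ⟨v, hvT, hvA⟩ := Finset.exists_of_ssubset (hA.ssubset_of_ne hAT)
    have h1 := (ih _ (Finset.erase_ssubset hvT)).2 A (Finset.subset_erase.2 ⟨hA, hvA⟩)
    have h2 := step v hvT
    have h3 := mul_le_mul_of_nonneg_left h1 (hI T).le
    have h4 := mul_le_mul_of_nonneg_right h2 (hI A).le
    refine le_of_mul_le_mul_left ?_ (hI (T.erase v))
    linarith

theorem indepPolyOn_le_of_recursion (G : SimpleGraph V) {r : V → R} (hr : ∀ v, 0 ≤ r v)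
    (hI : ∀ T, 0 < indepPolyOn G r T) {Q : Finset V → R} (hQ0 : Q ∅ = 1)
    (hQ : ∀ v T, v ∉ T → Q T - r v * Q (nonNbrs G v T) ≤ Q (insert v T)) (T : Finset V) :
    indepPolyOn G r T ≤ Q T := by
  simpa [hQ0] using (shearer_ratio_bound G hr hI hQ0 hQ T).2 ∅ (Finset.empty_subset T)

/-- Vertices outside `T` and not adjacent to any vertex of `A`. -/
noncomputable def outside (G : SimpleGraph V) (A T : Finset V) : Finset V :=
  open scoped Classical in T.filter fun w => w ∉ A ∧ ∀ a ∈ A, ¬ G.Adj a w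

-- The summand at `A` is the weight Shearer's measure gives to "exactly the events in `A` occur";
-- summing over `A ⊆ U` gives the probability that none in `T` occurs, when `U ∪ T` is everything.
-- Induct on `U`: sets avoiding `u` sum to I(T + u), sets containing `u` to the term that the
-- recursion subtracts there.
open scoped Classical in
theorem sum_indep_prod_mul_indepPolyOn (G : SimpleGraph V) (r : V → R) (U T : Finset V)
    (hUT : Disjoint U T) :
    ∑ A ∈ U.powerset, (if G.IsIndepSet (A : Set V) then
      (∏ v ∈ A, r v) * indepPolyOn G r (outside G A (U ∪ T)) else 0) = indepPolyOn G r T := by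
  induction U using Finset.strongInduction generalizing T with
  | H U ih =>
    rcases U.eq_empty_or_nonempty with rfl | ⟨u, hu⟩
    · simp [SimpleGraph.isIndepSet_iff, outside]
    have huT : u ∉ T := Finset.disjoint_left.1 hUT hu
    have hu' := Finset.notMem_erase u U
    have hss := Finset.erase_ssubset hu
    conv_lhs => rw [← Finset.insert_erase hu]
    rw [Finset.sum_powerset_insert hu']
    have h1 := ih (U.erase u) hss (insert u T) (by
      rw [Finset.disjoint_insert_right]
      exact ⟨hu', hUT.mono_left hss.subset⟩)
    have h2 := ih (nonNbrs G u (U.erase u)) (nonNbrs_erase_ssubset G hu) (nonNbrs G u T)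
      (hUT.mono (nonNbrs_erase_ssubset G hu).subset (nonNbrs_subset G u T))
    rw [indepPolyOn_insert G r huT] at h1
    rw [Finset.insert_union, ← Finset.union_insert, h1, sub_add_eq_add_sub, sub_eq_iff_eq_add, add_right_inj,
      ← h2, Finset.mul_sum]
    symm
    refine Finset.sum_subset_zero_on_sdiff (Finset.powerset_mono.2 (nonNbrs_subset _ _ _)) ?_ ?_
    · intro A hA
      simp only [Finset.mem_sdiff, Finset.mem_powerset] at hA
      rw [if_neg]
      rw [isIndepSet_insert_iff fun h => hu' (hA.1 h)]
      rintro ⟨-, h⟩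
      exact hA.2 fun w hw => mem_nonNbrs.2 ⟨hA.1 hw, h w hw⟩
    · intro A hA
      rw [Finset.mem_powerset] at hA
      have huA : u ∉ A := fun h => hu' (nonNbrs_subset _ _ _ (hA h))
      have : G.IsIndepSet ((insert u A : Finset V) : Set V) ↔ G.IsIndepSet (A : Set V) := by
        rw [isIndepSet_insert_iff huA]
        exact and_iff_left fun w hw => (mem_nonNbrs.1 (hA hw)).2
      simp only [this]
      split_ifs
      · rw [Finset.prod_insert huA, mul_assoc]
        congr 3
        ext w
        simp only [outside, Finset.mem_filter, Finset.mem_union, mem_nonNbrs, Finset.mem_erase,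
          Finset.mem_insert, forall_eq_or_imp, not_or]
        grind
      · simp

end Shearer

/-! ### Shearer's theorem for the abstract interior -/

theorem IsDependencyGraph.measure_inter {V Ω : Type*} [MeasurableSpace Ω] {P : Measure Ω}
    {G : SimpleGraph V} {A : V → Set Ω} (h : IsDependencyGraph P G A) (v : V) (T : Finset V)
    (hT : ∀ w ∈ T, w ≠ v ∧ ¬ G.Adj v w) :
    P (A v ∩ ⋂ w ∈ T, (A w)ᶜ) = P (A v) * P (⋂ w ∈ T, (A w)ᶜ) := by
  refine (ProbabilityTheory.Indep_iff _ _ _).1 (h v) _ _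
    (MeasurableSpace.measurableSet_generateFrom rfl) ?_
  refine Finset.measurableSet_biInter T fun w hw => MeasurableSet.compl ?_
  exact MeasurableSpace.measurableSet_generateFrom ⟨w, (hT w hw).1, (hT w hw).2, rfl⟩

/-- The avoidance probabilities satisfy the recursive inequality: the part of `A v` inside the
avoidance of `T` lies in the avoidance of the non-neighbours only, from which `A v` is independent.
-/
theorem mem_abstractInterior_of_pos {V : Type*} [DecidableEq V] [Fintype V] {G : SimpleGraph V} {r : V → ℝ}
    (hr : ∀ v, 0 ≤ r v) (hI : ∀ T, 0 < indepPolyOn G r T) : r ∈ abstractInterior G := by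
  intro Ω _ P _ A hA hdep hP
  have hmeas : ∀ T : Finset V, MeasurableSet (⋂ w ∈ T, (A w)ᶜ) := fun T =>
    Finset.measurableSet_biInter T fun w _ => (hA w).compl
  have key := indepPolyOn_le_of_recursion G hr hI (Q := fun T => P.real (⋂ w ∈ T, (A w)ᶜ))
    (by simp) (fun v T hv => ?_) Finset.univ
  · have h1 : 0 < P.real (⋂ w ∈ (Finset.univ : Finset V), (A w)ᶜ) := (hI _).trans_le key
    simp only [Finset.mem_univ, Set.iInter_true] at h1
    exact (ENNReal.toReal_pos_iff.1 h1).1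
  · have h1 : P.real (⋂ w ∈ T, (A w)ᶜ) =
        P.real ((⋂ w ∈ T, (A w)ᶜ) ∩ A v) + P.real ((⋂ w ∈ T, (A w)ᶜ) \ A v) :=
      (measureReal_inter_add_sdiff (hA v)).symm
    have h2 : (⋂ w ∈ insert v T, (A w)ᶜ) = (⋂ w ∈ T, (A w)ᶜ) \ A v := by
      rw [Finset.set_biInter_insert, Set.inter_comm]; rfl
    have h3 : P.real ((⋂ w ∈ T, (A w)ᶜ) ∩ A v) ≤
        r v * P.real (⋂ w ∈ nonNbrs G v T, (A w)ᶜ) := by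
      have h4 := hdep.measure_inter v (nonNbrs G v T) fun w hw =>
        ⟨fun h => hv (h ▸ (mem_nonNbrs.1 hw).1), (mem_nonNbrs.1 hw).2⟩
      have h5 : P.real (A v ∩ ⋂ w ∈ nonNbrs G v T, (A w)ᶜ) =
          r v * P.real (⋂ w ∈ nonNbrs G v T, (A w)ᶜ) := by
        simp only [Measure.real, h4, ENNReal.toReal_mul, hP, ENNReal.toReal_ofReal (hr v)]
      rw [← h5, Set.inter_comm]
      refine measureReal_mono (Set.inter_subset_inter_right _ ?_)
      exact Set.biInter_subset_biInter_left fun w hw => nonNbrs_subset G v T hw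
    rw [h2]
    linarith

/-- Finite intersections of complements form a π-system generating the relevant σ-algebra, so
product formulas for avoidance probabilities are enough. -/
theorem isDependencyGraph_of_compl {V Ω : Type*} [DecidableEq V] [MeasurableSpace Ω] {P : Measure Ω}
    [IsProbabilityMeasure P] {G : SimpleGraph V} {A : V → Set Ω} (hA : ∀ v, MeasurableSet (A v))
    (h : ∀ v, ∀ T : Finset V, (∀ w ∈ T, w ≠ v ∧ ¬ G.Adj v w) →
      P ((A v)ᶜ ∩ ⋂ w ∈ T, (A w)ᶜ) = P (A v)ᶜ * P (⋂ w ∈ T, (A w)ᶜ)) :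
    IsDependencyGraph P G A := by
  intro v
  set π : Set (Set Ω) :=
    {B | ∃ T : Finset V, (∀ w ∈ T, w ≠ v ∧ ¬ G.Adj v w) ∧ B = ⋂ w ∈ T, (A w)ᶜ} with hπ
  have h1 : ProbabilityTheory.Indep (MeasurableSpace.generateFrom {(A v)ᶜ})
      (MeasurableSpace.generateFrom π) P := by
    refine ProbabilityTheory.IndepSets.indep (p1 := {(A v)ᶜ}) (p2 := π) ?_ ?_
      (IsPiSystem.singleton _) ?_ rfl rfl ?_
    · exact MeasurableSpace.generateFrom_le fun s hs => by
        rw [Set.mem_singleton_iff.1 hs]; exact (hA v).compl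
    · refine MeasurableSpace.generateFrom_le fun s hs => ?_
      obtain ⟨T, -, rfl⟩ := hs
      exact Finset.measurableSet_biInter T fun w _ => (hA w).compl
    · rintro _ ⟨T, hT, rfl⟩ _ ⟨T', hT', rfl⟩ -
      refine ⟨T ∪ T', fun w hw => ?_, ?_⟩
      · rcases Finset.mem_union.1 hw with hw | hw
        exacts [hT w hw, hT' w hw]
      · rw [Finset.set_biInter_inter]
    · rw [ProbabilityTheory.IndepSets_iff]
      rintro _ _ rfl ⟨T, hT, rfl⟩
      exact h v T hT
  refine ProbabilityTheory.indep_of_indep_of_le_left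
    (ProbabilityTheory.indep_of_indep_of_le_right h1 ?_) ?_
  · refine MeasurableSpace.generateFrom_le ?_
    rintro _ ⟨w, hwv, hadj, rfl⟩
    rw [← MeasurableSet.compl_iff]
    exact MeasurableSpace.measurableSet_generateFrom ⟨{w}, by simp [hwv, hadj], by simp⟩
  · refine MeasurableSpace.generateFrom_le ?_
    rintro _ rfl
    rw [← MeasurableSet.compl_iff]
    exact MeasurableSpace.measurableSet_generateFrom rfl

theorem exists_shearer_measure {V : Type} [DecidableEq V] [Fintype V] (G : SimpleGraph V)
    {r : V → ℝ} (hr : ∀ v, 0 ≤ r v) (hI : ∀ T, 0 ≤ indepPolyOn G r T) :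
    ∃ P : @Measure (Finset V) ⊤, @IsProbabilityMeasure _ ⊤ P ∧
      ∀ T, P {A | Disjoint A T} = ENNReal.ofReal (indepPolyOn G r T) := by
  classical
  let _ : MeasurableSpace (Finset V) := ⊤
  set w : Finset V → ℝ := fun A => if G.IsIndepSet (A : Set V) then
      (∏ v ∈ A, r v) * indepPolyOn G r (outside G A Finset.univ) else 0 with hw
  have hw0 : ∀ A, 0 ≤ w A := fun A => by
    simp only [hw]
    split_ifs
    · exact mul_nonneg (Finset.prod_nonneg fun v _ => hr v) (hI _)
    · exact le_rfl
  set P : Measure (Finset V) := ∑ A, ENNReal.ofReal (w A) • Measure.dirac A with hP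
  have hPT : ∀ T, P {A | Disjoint A T} = ENNReal.ofReal (indepPolyOn G r T) := by
    intro T
    have h1 := sum_indep_prod_mul_indepPolyOn G r Tᶜ T disjoint_compl_left
    rw [show Tᶜ ∪ T = Finset.univ by rw [Finset.union_comm, Finset.union_compl]] at h1
    rw [← h1, ENNReal.ofReal_sum_of_nonneg fun A _ => hw0 A, hP]
    simp only [Measure.coe_finsetSum, Finset.sum_apply, Measure.smul_apply, smul_eq_mul]
    symm
    rw [← Finset.sum_subset (Finset.subset_univ (Tᶜ).powerset)]
    · refine Finset.sum_congr rfl fun A hA => ?_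
      rw [Measure.dirac_apply' _ MeasurableSpace.measurableSet_top, Set.indicator_of_mem]
      · simp [hw]
      · rw [Finset.mem_powerset] at hA
        exact (disjoint_compl_left (a := T)).mono_left hA
    · intro A _ hA
      rw [Measure.dirac_apply' _ MeasurableSpace.measurableSet_top, Set.indicator_of_notMem, mul_zero]
      rw [Finset.mem_powerset] at hA
      exact fun h : Disjoint A T => hA (le_compl_iff_disjoint_right.2 h)
  refine ⟨P, ⟨?_⟩, hPT⟩
  have := hPT ∅
  simpa using this

/-- Draw Shearer's random independent set for `ρ` and an independent coin for each vertex; the event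
of `v` is that `v` is drawn or its coin shows true. Coins preserve the dependency graph and raise
the probabilities to `r`, and avoiding `S` still has probability zero. -/
theorem notMem_abstractInterior_of_le {V : Type} [DecidableEq V] [Fintype V] {G : SimpleGraph V}
    {r ρ : V → ℝ} (hρ : ∀ v, 0 ≤ ρ v) (hρr : ∀ v, ρ v ≤ r v) (hr1 : ∀ v, r v ≤ 1)
    (hI : ∀ T, 0 ≤ indepPolyOn G ρ T) {S : Finset V} (hS : indepPolyOn G ρ S = 0) :
    r ∉ abstractInterior G := by
  intro hmem
  let _ : MeasurableSpace (Finset V) := ⊤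
  obtain ⟨P, hP, hPT⟩ := exists_shearer_measure G hρ hI
  -- Solves (1 - ρ)(1 - q) = 1 - r. If ρ = 1, then r = 1 as well and the junk value q = 0 is
  -- correct.
  set q : V → ℝ := fun v => (r v - ρ v) / (1 - ρ v) with hq
  have hρ1 : ∀ v, ρ v ≤ 1 := fun v => (hρr v).trans (hr1 v)
  have hq0 : ∀ v, 0 ≤ q v := fun v =>
    div_nonneg (sub_nonneg.2 (hρr v)) (sub_nonneg.2 (hρ1 v))
  have hq1 : ∀ v, q v ≤ 1 := fun v =>
    div_le_one_of_le₀ (by linarith [hr1 v]) (sub_nonneg.2 (hρ1 v))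
  have hqr : ∀ v, (1 - ρ v) * (1 - q v) = 1 - r v := by
    intro v
    rcases (hρ1 v).eq_or_lt with h | h
    · have : r v = 1 := le_antisymm (hr1 v) (h ▸ hρr v)
      simp [h, this]
    · have : 1 - ρ v ≠ 0 := by linarith
      simp only [hq]
      field_simp
      ring
  set C : V → Measure Bool := fun v =>
    ENNReal.ofReal (q v) • Measure.dirac true + ENNReal.ofReal (1 - q v) • Measure.dirac false with hC
  have hCp : ∀ v, IsProbabilityMeasure (C v) := fun v => ⟨by
    simp only [hC, Measure.add_apply, Measure.smul_apply, measure_univ, smul_eq_mul, mul_one]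
    rw [← ENNReal.ofReal_add (hq0 v) (by linarith [hq1 v])]
    simp⟩
  have hCf : ∀ v, C v {false} = ENNReal.ofReal (1 - q v) := fun v => by simp [hC]
  set M : Measure (Finset V × (V → Bool)) := P.prod (Measure.pi C) with hM
  have hMp : IsProbabilityMeasure M := by rw [hM]; infer_instance
  set A : V → Set (Finset V × (V → Bool)) := fun v => {x | v ∈ x.1 ∨ x.2 v = true} with hAdef
  have hA : ∀ v, MeasurableSet (A v) := fun v => MeasurableSet.of_discrete
  have hset : ∀ T : Finset V, (⋂ w ∈ T, (A w)ᶜ) = {B : Finset V | Disjoint B T} ×ˢ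
      Set.pi Set.univ (fun w => if w ∈ T then {false} else Set.univ) := by
    intro T
    ext ⟨B, b⟩
    simp only [hAdef, Set.mem_iInter, Set.mem_compl_iff, Set.mem_ofPred_eq, not_or, Set.mem_prod,
      Set.mem_pi, Set.mem_univ, true_implies, Finset.disjoint_right, Bool.not_eq_true]
    constructor
    · intro h
      refine ⟨fun w hw => (h w hw).1, fun w => ?_⟩
      split_ifs with hw
      · exact (h w hw).2
      · trivial
    · rintro ⟨h1, h2⟩ w hw
      have := h2 w
      rw [if_pos hw] at this
      exact ⟨h1 hw, this⟩
  have hMT : ∀ T : Finset V, M (⋂ w ∈ T, (A w)ᶜ) =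
      ENNReal.ofReal (indepPolyOn G ρ T * ∏ w ∈ T, (1 - q w)) := by
    intro T
    rw [hset, hM, Measure.prod_prod, hPT, Measure.pi_pi, ENNReal.ofReal_mul (hI T),
      ENNReal.ofReal_prod_of_nonneg fun w _ => by linarith [hq1 w]]
    congr 1
    rw [← Finset.prod_subset (Finset.subset_univ T)]
    · exact Finset.prod_congr rfl fun w hw => by rw [if_pos hw, hCf]
    · intro w _ hw
      rw [if_neg hw]; exact measure_univ
  have hMc : ∀ v, M (A v)ᶜ = ENNReal.ofReal (1 - r v) := by
    intro v
    have h1 := hMT {v}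
    rw [← insert_empty_eq, indepPolyOn_insert G ρ (Finset.notMem_empty v)] at h1
    simpa [hqr, nonNbrs] using h1
  have hdep : IsDependencyGraph M G A := by
    refine isDependencyGraph_of_compl hA fun v T hT => ?_
    have hv : v ∉ T := fun h => (hT v h).1 rfl
    have hnn : nonNbrs G v T = T := by
      ext w
      rw [mem_nonNbrs]
      exact ⟨fun h => h.1, fun h => ⟨h, (hT w h).2⟩⟩
    have h1 := hMT (insert v T)
    rw [Finset.set_biInter_insert] at h1
    rw [h1, hMc, hMT, ← ENNReal.ofReal_mul (by linarith [hr1 v]), indepPolyOn_insert G ρ hv, hnn,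
      Finset.prod_insert hv, ← hqr]
    congr 1
    ring
  have hMA : ∀ v, M (A v) = ENNReal.ofReal (r v) := by
    intro v
    have h1 := prob_compl_eq_one_sub (μ := M) (hA v).compl
    rw [compl_compl, hMc, ← ENNReal.ofReal_one, ← ENNReal.ofReal_sub _ (by linarith [hr1 v])] at h1
    rw [h1]
    congr 1
    ring
  have h1 := hmem _ M A hA hdep hMA
  have h2 : M (⋂ i, (A i)ᶜ) ≤ M (⋂ w ∈ S, (A w)ᶜ) :=
    measure_mono fun x hx => Set.mem_iInter₂.2 fun w _ => Set.mem_iInter.1 hx w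
  rw [hMT, hS, zero_mul, ENNReal.ofReal_zero] at h2
  exact absurd h1 (not_lt.2 h2)

theorem exists_minimal_indepPolyOn_nonpos {V R : Type*} [DecidableEq V] [CommRing R]
    [LinearOrder R] (G : SimpleGraph V) (r : V → R) {T : Finset V} (hT : indepPolyOn G r T ≤ 0) :
    ∃ S ⊆ T, indepPolyOn G r S ≤ 0 ∧ ∀ A, A ⊂ S → 0 < indepPolyOn G r A := by
  obtain ⟨S, hST, hS⟩ := exists_minimal_le_of_wellFoundedLT
    (fun S => indepPolyOn G r S ≤ 0) T hT
  refine ⟨S, hST, hS.prop, fun A hA => ?_⟩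
  by_contra hcon
  exact hA.not_subset (hS.le_of_le (not_lt.1 hcon) hA.subset)

theorem mem_abstractInterior_iff {V : Type} [DecidableEq V] [Fintype V] {G : SimpleGraph V}
    {r : V → ℝ} (hr : ∀ v, 0 ≤ r v ∧ r v ≤ 1) :
    r ∈ abstractInterior G ↔ ∀ T, 0 < indepPolyOn G r T := by
  refine ⟨fun hmem => ?_, mem_abstractInterior_of_pos fun v => (hr v).1⟩
  by_contra! hcon
  obtain ⟨T, hT⟩ := hcon
  obtain ⟨S, -, hS, hmin⟩ := exists_minimal_indepPolyOn_nonpos G r hT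
  have hSne : S.Nonempty := by
    rw [Finset.nonempty_iff_ne_empty]
    rintro rfl
    rw [indepPolyOn_empty] at hS
    linarith
  obtain ⟨v, hv⟩ := hSne
  have h1 := hmin _ (Finset.erase_ssubset hv)
  have h2 := hmin _ (nonNbrs_erase_ssubset G hv)
  -- The value of the coordinate `v` at which I(S) is exactly zero; it is at most `r v` because I(S)
  -- ≤ 0 there.
  set c := indepPolyOn G r (S.erase v) / indepPolyOn G r (nonNbrs G v (S.erase v)) with hc
  have hc0 : 0 ≤ c := (div_pos h1 h2).le
  have hcr : c ≤ r v := by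
    rw [hc, div_le_iff₀ h2]
    rw [indepPolyOn_eq_sub G r hv] at hS
    linarith
  -- Zeros outside `S` reduce every I(A) to a subset of `S`, and lowering the coordinate `v` can
  -- only increase I on proper subsets.
  set ρ : V → ℝ := fun w => if w ∈ S then (if w = v then c else r w) else 0 with hρ
  have hρv : ρ v = c := by simp [hρ, hv]
  have hρe : ∀ A ⊆ S.erase v, indepPolyOn G ρ A = indepPolyOn G r A := fun A hA =>
    indepPolyOn_congr G fun w hw => by
      have := Finset.mem_erase.1 (hA hw)
      simp [hρ, this.1, this.2]
  have hρS : indepPolyOn G ρ S = 0 := by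
    rw [indepPolyOn_eq_sub G ρ hv, hρv, hρe _ (Finset.Subset.refl _), hρe _ (nonNbrs_subset _ _ _),
      hc, div_mul_cancel₀ _ h2.ne', sub_self]
  refine notMem_abstractInterior_of_le (ρ := ρ) (fun w => ?_) (fun w => ?_) (fun w => (hr w).2)
    (fun A => ?_) hρS hmem
  · simp only [hρ]
    split_ifs
    exacts [hc0, (hr w).1, le_rfl]
  · simp only [hρ]
    split_ifs with h h'
    exacts [h' ▸ hcr, le_rfl, (hr w).1]
  · rw [indepPolyOn_inter G (S := S) (fun w hw => by simp [hρ, hw])]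
    have hAS : A ∩ S ⊆ S := Finset.inter_subset_right
    by_cases hAeq : A ∩ S = S
    · rw [hAeq, hρS]
    by_cases hvA : v ∈ A ∩ S
    · have h3 : (A ∩ S).erase v ⊆ S.erase v := Finset.erase_subset_erase v hAS
      have h4 : 0 < indepPolyOn G r (A ∩ S) := hmin _ (hAS.ssubset_of_ne hAeq)
      have h5 : 0 < indepPolyOn G r (nonNbrs G v ((A ∩ S).erase v)) :=
        hmin _ ((nonNbrs_erase_ssubset G hvA).trans_subset hAS)
      rw [indepPolyOn_eq_sub G r hvA] at h4
      rw [indepPolyOn_eq_sub G ρ hvA, hρv, hρe _ h3, hρe _ ((nonNbrs_subset _ _ _).trans h3)]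
      have := mul_le_mul_of_nonneg_right hcr h5.le
      linarith
    · rw [hρe _ (Finset.subset_erase.2 ⟨hAS, hvA⟩)]
      exact (hmin _ (hAS.ssubset_of_ne hAeq)).le

/-! ### Block subspaces of function spaces -/

section Block

variable {X' B X ι : Type*}

/-- The functions on `X' ≃ B × X` whose slice over each `b` lies in `L b`. -/
def blockSubmodule (e : X' ≃ B × X) (L : B → Submodule ℂ (X → ℂ)) : Submodule ℂ (X' → ℂ) where
  carrier := {f | ∀ b, (fun a => f (e.symm (b, a))) ∈ L b}
  add_mem' hf hg b := (L b).add_mem (hf b) (hg b)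
  zero_mem' b := (L b).zero_mem
  smul_mem' c _ hf b := (L b).smul_mem c (hf b)

/-- A block subspace is the product of its blocks. -/
def blockSubmoduleEquiv (e : X' ≃ B × X) (L : B → Submodule ℂ (X → ℂ)) :
    blockSubmodule e L ≃ₗ[ℂ] (∀ b, L b) where
  toFun f b := ⟨fun a => f.1 (e.symm (b, a)), f.2 b⟩
  invFun g := ⟨fun x => (g (e x).1).1 (e x).2, fun b => by
    have h : ∀ p, (g (e (e.symm p)).1).1 (e (e.symm p)).2 = (g p.1).1 p.2 := fun p => by
      rw [e.apply_symm_apply]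
    simp only [h]
    exact (g b).2⟩
  map_add' _ _ := rfl
  map_smul' _ _ := rfl
  left_inv f := by ext x; simp
  right_inv g := by
    ext b a
    have h : ∀ p, (g (e (e.symm p)).1).1 (e (e.symm p)).2 = (g p.1).1 p.2 := fun p => by
      rw [e.apply_symm_apply]
    exact h (b, a)

theorem finrank_blockSubmodule [Fintype B] [Finite X] (e : X' ≃ B × X)
    (L : B → Submodule ℂ (X → ℂ)) :
    finrank ℂ (blockSubmodule e L) = ∑ b, finrank ℂ (L b) := by
  rw [(blockSubmoduleEquiv e L).finrank_eq, finrank_pi_fintype]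

theorem relDim_blockSubmodule [Fintype X'] [Fintype B] [Fintype X] (e : X' ≃ B × X)
    (L : B → Submodule ℂ (X → ℂ)) :
    relDim (blockSubmodule e L) = (∑ b, relDim (L b)) / Fintype.card B := by
  simp only [relDim, finrank_blockSubmodule, finrank_fintype_fun_eq_card, Fintype.card_congr e,
    Fintype.card_prod, Nat.cast_mul, Nat.cast_sum]
  rw [← Finset.sum_div, div_div, mul_comm (Fintype.card B : ℚ)]

theorem relDim_blockSubmodule_const [Fintype X'] [Fintype B] [Nonempty B] [Fintype X]
    (e : X' ≃ B × X) (L : Submodule ℂ (X → ℂ)) :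
    relDim (blockSubmodule e fun _ => L) = relDim L := by
  rw [relDim_blockSubmodule]
  have : (Fintype.card B : ℚ) ≠ 0 := Nat.cast_ne_zero.2 Fintype.card_ne_zero
  simp [this]

theorem blockSubmodule_mono (e : X' ≃ B × X) {L L' : B → Submodule ℂ (X → ℂ)}
    (h : ∀ b, L b ≤ L' b) : blockSubmodule e L ≤ blockSubmodule e L' :=
  fun _ hf b => h b (hf b)

/-- A function is the sum of its pieces supported on single blocks, and each piece can be treated
separately. -/
theorem blockSubmodule_iSup_le [Fintype B] (e : X' ≃ B × X)
    (M : ι → B → Submodule ℂ (X → ℂ)) :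
    blockSubmodule e (fun b => ⨆ i, M i b) ≤ ⨆ i, blockSubmodule e (M i) := by
  classical
  intro f hf
  let inc : B → (X → ℂ) →ₗ[ℂ] (X' → ℂ) := fun b =>
    { toFun := fun g x => if (e x).1 = b then g (e x).2 else 0
      map_add' := fun g h => by ext x; simp only [Pi.add_apply]; split_ifs <;> simp
      map_smul' := fun c g => by
        ext x; simp only [Pi.smul_apply, RingHom.id_apply]; split_ifs <;> simp }
  have hinc : ∀ i b, ∀ g ∈ M i b, inc b g ∈ blockSubmodule e (M i) := by
    intro i b g hg b'
    by_cases h : b' = b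
    · subst h; simpa [inc] using hg
    · simp only [inc, h, LinearMap.coe_mk, AddHom.coe_mk, Equiv.apply_symm_apply, if_false]
      exact (M i b').zero_mem
  have hsum : f = ∑ b, inc b (fun a => f (e.symm (b, a))) := by
    ext x
    simp [inc, Finset.sum_apply]
  rw [hsum]
  refine Submodule.sum_mem _ fun b _ => ?_
  have h1 : (⨆ i, M i b).map (inc b) ≤ ⨆ i, blockSubmodule e (M i) := by
    rw [Submodule.map_iSup]
    refine iSup_mono fun i => ?_
    rintro _ ⟨g, hg, rfl⟩
    exact hinc i b g hg
  exact h1 (Submodule.mem_map_of_mem (hf b))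

theorem relDim_mono {H : Type*} [AddCommGroup H] [Module ℂ H] [FiniteDimensional ℂ H]
    {W W' : Submodule ℂ H} (h : W ≤ W') : relDim W ≤ relDim W' := by
  unfold relDim
  gcongr
  exact_mod_cast Submodule.finrank_mono h

theorem relDim_nonneg {H : Type*} [AddCommGroup H] [Module ℂ H] (W : Submodule ℂ H) :
    0 ≤ relDim W := by
  unfold relDim; positivity

theorem relDim_le_one {H : Type*} [AddCommGroup H] [Module ℂ H] [FiniteDimensional ℂ H]
    (W : Submodule ℂ H) : relDim W ≤ 1 :=
  div_le_one_of_le₀ (by exact_mod_cast Submodule.finrank_le W) (by positivity)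

end Block

/-! ### Extension of local subspaces to all sites -/

section Extension

variable {Q : Type*} [Fintype Q] [DecidableEq Q] {α : Q → Type*}

/-- Split a configuration into its parts outside and inside `S`. -/
def splitConfig (α : Q → Type*) (S : Finset Q) :
    (∀ j, α j) ≃ (∀ j : ↥Sᶜ, α j) × (∀ j : S, α j) where
  toFun z := (fun j => z j, fun j => z j)
  invFun p j := if h : j ∈ S then p.2 ⟨j, h⟩ else p.1 ⟨j, Finset.mem_compl.2 h⟩
  left_inv z := by ext j; simp
  right_inv p := by
    ext j
    · simp [Finset.mem_compl.1 j.2]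
    · simp

theorem splitConfig_symm_of_mem {S : Finset Q} (p : (∀ j : ↥Sᶜ, α j) × (∀ j : S, α j)) {j : Q}
    (h : j ∈ S) : (splitConfig α S).symm p j = p.2 ⟨j, h⟩ := dif_pos h

theorem splitConfig_symm_of_notMem {S : Finset Q} (p : (∀ j : ↥Sᶜ, α j) × (∀ j : S, α j)) {j : Q}
    (h : j ∉ S) : (splitConfig α S).symm p j = p.1 ⟨j, Finset.mem_compl.2 h⟩ := dif_neg h

/-- The extension of a local subspace by the full space of the sites outside `S`. -/
def extendLocal (S : Finset Q) (L : Submodule ℂ ((∀ j : S, α j) → ℂ)) :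
    Submodule ℂ ((∀ j, α j) → ℂ) :=
  blockSubmodule (splitConfig α S) fun _ => L

theorem mem_extendLocal {S : Finset Q} {L : Submodule ℂ ((∀ j : S, α j) → ℂ)} {f : (∀ j, α j) → ℂ} :
    f ∈ extendLocal S L ↔ ∀ y, (fun x => f ((splitConfig α S).symm (y, x))) ∈ L := Iff.rfl

theorem extendLocal_mono {S : Finset Q} {L L' : Submodule ℂ ((∀ j : S, α j) → ℂ)} (h : L ≤ L') :
    extendLocal S L ≤ extendLocal S L' := blockSubmodule_mono _ fun _ => h

theorem tensorRest_eq_extendLocal (d : Q → ℕ) (S : Finset Q) (L : Submodule ℂ (QuditSpace d S)) :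
    tensorRest d S L = extendLocal S L := by
  apply le_antisymm
  · refine Submodule.span_le.2 ?_
    rintro _ ⟨v, hv, w, rfl⟩ y
    have h1 : ∀ x, S.restrict ((splitConfig (fun j => Fin (d j)) S).symm (y, x)) = x := fun x => by
      ext j; simp [Finset.restrict, splitConfig_symm_of_mem _ j.2]
    have h2 : ∀ x, Sᶜ.restrict ((splitConfig (fun j => Fin (d j)) S).symm (y, x)) = y := fun x => by
      ext j; simp [Finset.restrict, splitConfig_symm_of_notMem _ (Finset.mem_compl.1 j.2)]
    simp only [h1, h2, mul_comm _ (w y)]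
    exact L.smul_mem (w y) hv
  · intro f hf
    have h1 : f = ∑ y : Config d Sᶜ, fun z => f ((splitConfig _ S).symm (y, S.restrict z)) *
        (Pi.single y 1 : Config d Sᶜ → ℂ) (Sᶜ.restrict z) := by
      ext z
      rw [Finset.sum_apply, Finset.sum_eq_single (Sᶜ.restrict z)]
      · simp only [Pi.single_eq_same, mul_one]
        exact congrArg f ((splitConfig _ S).symm_apply_apply z).symm
      · intro y _ hy
        rw [Pi.single_eq_of_ne (Ne.symm hy), mul_zero]
      · simp
    rw [h1]
    exact Submodule.sum_mem _ fun y _ => Submodule.subset_span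
      ⟨_, hf y, (Pi.single y 1 : Config d Sᶜ → ℂ), rfl⟩

theorem relDim_extendLocal [∀ j, Fintype (α j)] [∀ j, Nonempty (α j)] (S : Finset Q)
    (L : Submodule ℂ ((∀ j : S, α j) → ℂ)) : relDim (extendLocal S L) = relDim L :=
  relDim_blockSubmodule_const _ _

/-- Apply an operator on the sites in `S` to the space of all sites. -/
def localOp (S : Finset Q) :
    (((∀ j : S, α j) → ℂ) →ₗ[ℂ] ((∀ j : S, α j) → ℂ)) →ₗ[ℂ]
      ((∀ j, α j) → ℂ) →ₗ[ℂ] ((∀ j, α j) → ℂ) :=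
  LinearMap.mk₂ ℂ (fun X f z => X (fun x => f ((splitConfig α S).symm ((splitConfig α S z).1, x)))
      (splitConfig α S z).2)
    (fun _ _ _ => rfl) (fun _ _ _ => rfl)
    (fun X f g => by ext z; exact congrFun (X.map_add _ _) _)
    (fun c X f => by ext z; exact congrFun (X.map_smul _ _) _)

theorem localOp_apply (S : Finset Q) (X : ((∀ j : S, α j) → ℂ) →ₗ[ℂ] ((∀ j : S, α j) → ℂ))
    (f : (∀ j, α j) → ℂ) (y : ∀ j : ↥Sᶜ, α j) :
    (fun x => localOp S X f ((splitConfig α S).symm (y, x))) =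
      X fun x => f ((splitConfig α S).symm (y, x)) := by
  ext x
  simp [localOp]

theorem extendLocal_map (S : Finset Q) (X : ((∀ j : S, α j) → ℂ) →ₗ[ℂ] ((∀ j : S, α j) → ℂ))
    (W : Submodule ℂ ((∀ j : S, α j) → ℂ)) :
    extendLocal S (W.map X) = (extendLocal S W).map (localOp S X) := by
  apply le_antisymm
  · intro f hf
    choose w hw hwf using fun y => Submodule.mem_map.1 (mem_extendLocal.1 hf y)
    refine ⟨fun z => w (splitConfig α S z).1 (splitConfig α S z).2, fun y => ?_, ?_⟩
    · simpa using hw y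
    · ext z
      obtain ⟨⟨y, x⟩, rfl⟩ := (splitConfig α S).symm.surjective z
      have h1 := congrFun (localOp_apply S X
        (fun z => w (splitConfig α S z).1 (splitConfig α S z).2) y) x
      simp only [Equiv.apply_symm_apply, hwf y] at h1
      exact h1
  · rintro _ ⟨f, hf, rfl⟩
    intro y
    rw [localOp_apply]
    exact Submodule.mem_map_of_mem (hf y)

end Extension

/-! ### Enlarging all sites -/

section Enlarge

/-- Split each site of a family of sites into two factors. -/
def splitSites {ι : Type*} {α' β α : ι → Type*} (e : ∀ j, α' j ≃ β j × α j) :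
    (∀ j, α' j) ≃ (∀ j, β j) × (∀ j, α j) :=
  (Equiv.piCongrRight e).trans (Equiv.arrowProdEquivProdArrow ι β α)

theorem splitSites_symm_apply {ι : Type*} {α' β α : ι → Type*} (e : ∀ j, α' j ≃ β j × α j)
    (p : (∀ j, β j) × (∀ j, α j)) (j : ι) : (splitSites e).symm p j = (e j).symm (p.1 j, p.2 j) :=
  rfl

/-- Lets a construction proceed block by block: subspaces depending only on the block labels of the
sites in `S` assemble into a single subspace that is local on `S`. -/
theorem blockSubmodule_extendLocal_le {Q : Type*} [Fintype Q] [DecidableEq Q] {α' β α : Q → Type*}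
    (e : ∀ j, α' j ≃ β j × α j) (S : Finset Q)
    (L : (∀ j : S, β j) → Submodule ℂ ((∀ j : S, α j) → ℂ)) :
    blockSubmodule (splitSites e) (fun b => extendLocal S (L fun j => b j)) ≤
      extendLocal S (blockSubmodule (splitSites fun j : S => e j) L) := by
  intro f hf y' b
  set bt : ∀ j, β j := (splitConfig β S).symm (fun j => (e j (y' j)).1, b) with hbt
  have h1 := hf bt (fun j => (e j (y' j)).2)
  have h2 : (fun j : S => bt j) = b := by
    ext j; rw [hbt, splitConfig_symm_of_mem _ j.2]
  rw [h2] at h1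
  convert! h1 using 3 with x
  refine congrArg f (funext fun j => ?_)
  rw [splitSites_symm_apply]
  by_cases hj : j ∈ S
  · have h3 : bt j = b ⟨j, hj⟩ := splitConfig_symm_of_mem _ hj
    simp only [splitConfig_symm_of_mem _ hj, splitSites_symm_apply, h3]
  · have h3 : bt j = (e j (y' ⟨j, Finset.mem_compl.2 hj⟩)).1 := splitConfig_symm_of_notMem _ hj
    simp only [splitConfig_symm_of_notMem _ hj, h3]
    exact ((e j).symm_apply_apply _).symm

end Enlarge

/-! ### Generic rank -/

section GenericRank

variable {E F H : Type*} [AddCommGroup E] [Module ℂ E] [AddCommGroup F] [Module ℂ F]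
  [AddCommGroup H] [Module ℂ H]

/-- The maps `φ` and `ψ` select a nonvanishing minor of size `k`; kept fixed while `T` varies, they
turn a rank bound into a polynomial condition. -/
theorem exists_det_ne_zero_of_le_finrank_range {k : ℕ} (T : F →ₗ[ℂ] H)
    (h : k ≤ finrank ℂ (LinearMap.range T)) :
    ∃ (φ : (Fin k → ℂ) →ₗ[ℂ] F) (ψ : H →ₗ[ℂ] (Fin k → ℂ)),
      (LinearMap.toMatrix' (ψ ∘ₗ T ∘ₗ φ)).det ≠ 0 := by
  obtain ⟨v, hv⟩ := exists_linearIndependent_of_le_finrank h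
  choose w hw using fun i => (v i).2
  let φ : (Fin k → ℂ) →ₗ[ℂ] F := Fintype.linearCombination ℂ w
  have hinj : LinearMap.ker (T ∘ₗ φ) = ⊥ := by
    have h1 : LinearIndependent ℂ (fun i => T (w i)) := by
      rw [show (fun i => T (w i)) = (LinearMap.range T).subtype ∘ v from funext hw]
      exact hv.map' _ (Submodule.ker_subtype _)
    rw [LinearMap.ker_eq_bot']
    intro c hc
    have h2 : ∑ i, c i • T (w i) = 0 := by
      simpa [φ, Fintype.linearCombination_apply, map_sum] using hc
    exact funext (Fintype.linearIndependent_iff.1 h1 c h2)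
  obtain ⟨ψ, hψ⟩ := LinearMap.exists_leftInverse_of_injective _ hinj
  exact ⟨φ, ψ, by rw [hψ]; simp⟩

theorem le_finrank_range_of_det_ne_zero [FiniteDimensional ℂ H] {k : ℕ} (T : F →ₗ[ℂ] H)
    (φ : (Fin k → ℂ) →ₗ[ℂ] F) (ψ : H →ₗ[ℂ] (Fin k → ℂ))
    (h : (LinearMap.toMatrix' (ψ ∘ₗ T ∘ₗ φ)).det ≠ 0) :
    k ≤ finrank ℂ (LinearMap.range T) := by
  have h1 : IsUnit (LinearMap.det (ψ ∘ₗ T ∘ₗ φ)) := by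
    rw [← LinearMap.det_toMatrix']; exact h.isUnit
  have h2 : Function.Injective (ψ ∘ₗ T ∘ₗ φ) :=
    (LinearEquiv.ofIsUnitDet (f := ψ ∘ₗ T ∘ₗ φ) (v := Pi.basisFun ℂ (Fin k))
      (v' := Pi.basisFun ℂ (Fin k)) (by simpa [LinearMap.toMatrix_eq_toMatrix'] using h)).injective
  have h3 : Function.Injective (T ∘ₗ φ) := by
    rw [LinearMap.coe_comp] at h2
    exact h2.of_comp
  have h4 := LinearMap.finrank_range_of_inj h3
  rw [finrank_fin_fun] at h4
  rw [← h4]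
  exact Submodule.finrank_mono (LinearMap.range_comp_le_range _ _)

/-- On the line joining a point good for the earlier functions to one good for the new function, all
restrictions are nonzero polynomials, so their product has a non-root. -/
theorem exists_forall_ne_zero_of_polynomial_on_lines {τ : Type*} [Finite τ] (f : τ → E → ℂ)
    (hline : ∀ t x y, ∃ p : Polynomial ℂ, ∀ s : ℂ, f t (x + s • (y - x)) = p.eval s)
    (hne : ∀ t, ∃ x, f t x ≠ 0) : ∃ x, ∀ t, f t x ≠ 0 := by
  classical
  cases nonempty_fintype τ
  suffices h : ∀ A : Finset τ, ∃ x, ∀ t ∈ A, f t x ≠ 0 by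
    obtain ⟨x, hx⟩ := h Finset.univ
    exact ⟨x, fun t => hx t (Finset.mem_univ t)⟩
  intro A
  induction A using Finset.induction_on with
  | empty => exact ⟨0, by simp⟩
  | insert a A _ ih =>
    obtain ⟨x, hx⟩ := ih
    obtain ⟨y, hy⟩ := hne a
    choose p hp using fun t => hline t x y
    have hA : ∀ t ∈ A, p t ≠ 0 := fun t ht h0 => hx t ht (by simpa [h0] using hp t 0)
    have ha : p a ≠ 0 := fun h0 => hy (by simpa [h0] using hp a 1)
    have hprod : ∏ t ∈ insert a A, p t ≠ 0 := by
      refine Finset.prod_ne_zero_iff.2 fun t ht => ?_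
      rcases Finset.mem_insert.1 ht with rfl | ht
      exacts [ha, hA t ht]
    obtain ⟨s, hs⟩ : ∃ s : ℂ, Polynomial.eval s (∏ t ∈ insert a A, p t) ≠ 0 := by
      by_contra! hcon
      exact hprod (Polynomial.funext fun s => by simpa using hcon s)
    rw [Polynomial.eval_prod] at hs
    exact ⟨x + s • (y - x), fun t ht => by
      rw [hp]; exact Finset.prod_ne_zero_iff.1 hs t ht⟩

theorem exists_polynomial_det_add_smul {k : ℕ} (M N : Matrix (Fin k) (Fin k) ℂ) :
    ∃ p : Polynomial ℂ, ∀ s : ℂ, (M + s • N).det = p.eval s := by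
  refine ⟨((M.map Polynomial.C + (Polynomial.X : Polynomial ℂ) • N.map Polynomial.C :
    Matrix (Fin k) (Fin k) (Polynomial ℂ))).det, fun s => ?_⟩
  rw [← Polynomial.coe_evalRingHom, RingHom.map_det]
  congr 1
  ext i j
  simpa using mul_comm _ _

theorem exists_common_generic_rank {τ : Type*} [Finite τ] {F H : τ → Type*}
    [∀ t, AddCommGroup (F t)] [∀ t, Module ℂ (F t)] [∀ t, AddCommGroup (H t)]
    [∀ t, Module ℂ (H t)] [∀ t, FiniteDimensional ℂ (H t)]
    (T : ∀ t, E → F t →ₗ[ℂ] H t)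
    (hT : ∀ t x y (s : ℂ), T t (x + s • (y - x)) = T t x + s • (T t y - T t x)) (x : τ → E) :
    ∃ z, ∀ t, finrank ℂ (LinearMap.range (T t (x t))) ≤ finrank ℂ (LinearMap.range (T t z)) := by
  choose φ ψ hφψ using fun t => exists_det_ne_zero_of_le_finrank_range (T t (x t)) le_rfl
  have hline : ∀ t a b, ∃ p : Polynomial ℂ, ∀ s : ℂ,
      (LinearMap.toMatrix' (ψ t ∘ₗ T t (a + s • (b - a)) ∘ₗ φ t)).det = p.eval s := by
    intro t a b
    obtain ⟨p, hp⟩ := exists_polynomial_det_add_smul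
      (LinearMap.toMatrix' (ψ t ∘ₗ T t a ∘ₗ φ t))
      (LinearMap.toMatrix' (ψ t ∘ₗ (T t b - T t a) ∘ₗ φ t))
    refine ⟨p, fun s => ?_⟩
    rw [← hp, hT, ← map_smul, ← map_add]
    congr 2
    ext
    simp
  obtain ⟨z, hz⟩ := exists_forall_ne_zero_of_polynomial_on_lines
    (fun t y => (LinearMap.toMatrix' (ψ t ∘ₗ T t y ∘ₗ φ t)).det) hline (fun t => ⟨x t, hφψ t⟩)
  exact ⟨z, fun t => le_finrank_range_of_det_ne_zero _ _ _ (hz t)⟩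

theorem range_sum_comp_proj {V : Type*} [Fintype V] {M : V → Type*}
    [∀ i, AddCommGroup (M i)] [∀ i, Module ℂ (M i)] (f : ∀ i, M i →ₗ[ℂ] H) :
    LinearMap.range (∑ i, f i ∘ₗ LinearMap.proj i) = ⨆ i, LinearMap.range (f i) := by
  classical
  apply le_antisymm
  · rintro _ ⟨x, rfl⟩
    rw [LinearMap.sum_apply]
    exact Submodule.sum_mem _ fun i _ =>
      Submodule.mem_iSup_of_mem i ⟨x i, rfl⟩
  · refine iSup_le fun i => ?_
    rintro _ ⟨x, rfl⟩
    refine ⟨Pi.single i x, ?_⟩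
    rw [LinearMap.sum_apply, Finset.sum_eq_single i]
    · simp
    · intro j _ hj
      simp [Pi.single_eq_of_ne hj]
    · simp

/-- Parametrises the subspaces of dimension at most dim `W` by operators, so that a choice of
subspace can be varied linearly. -/
theorem exists_map_eq_of_finrank_le [FiniteDimensional ℂ H] {L W : Submodule ℂ H}
    (h : finrank ℂ L ≤ finrank ℂ W) : ∃ X : H →ₗ[ℂ] H, W.map X = L := by
  obtain ⟨g, hg⟩ := LinearMap.exists_leftInverse_of_injective _ (W.ker_subtype)
  let i : L →ₗ[ℂ] W := (finBasis ℂ L).constr ℂ fun k => finBasis ℂ W (Fin.castLE h k)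
  have hi : LinearMap.ker i = ⊥ := by
    have h1 : LinearIndependent ℂ fun k => finBasis ℂ W (Fin.castLE h k) :=
      (finBasis ℂ W).linearIndependent.comp _ (Fin.castLE_injective h)
    have h2 : ⇑i ∘ finBasis ℂ L = fun k => finBasis ℂ W (Fin.castLE h k) := by
      ext k; simp [i]
    exact LinearMap.ker_eq_bot.2 
      (LinearMap.injective_of_linearIndependent (finBasis ℂ L).span_eq (h2 ▸ h1))
  obtain ⟨p, hp⟩ := LinearMap.exists_leftInverse_of_injective i hi
  refine ⟨L.subtype ∘ₗ p ∘ₗ g, ?_⟩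
  apply le_antisymm
  · rintro _ ⟨x, -, rfl⟩
    exact (p (g x)).2
  · intro x hx
    refine ⟨i ⟨x, hx⟩, (i ⟨x, hx⟩).2, ?_⟩
    have h1 : g (i ⟨x, hx⟩) = i ⟨x, hx⟩ := LinearMap.congr_fun hg _
    have h2 : p (i ⟨x, hx⟩) = ⟨x, hx⟩ := LinearMap.congr_fun hp _
    simp [h1, h2]

end GenericRank

/-! ### Sums of local subspaces -/

section LocalSum

variable {V Q : Type*} [Fintype V] [Fintype Q] [DecidableEq Q] {α : Q → Type*} (N : V → Finset Q)

/-- The linear map onto the sum of the extensions of the subspaces `X i (W i)`. -/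
noncomputable def localSumMap (W : ∀ i, Submodule ℂ ((∀ j : N i, α j) → ℂ)) :
    (∀ i, ((∀ j : N i, α j) → ℂ) →ₗ[ℂ] ((∀ j : N i, α j) → ℂ)) →ₗ[ℂ]
      (∀ i, extendLocal (N i) (W i)) →ₗ[ℂ] ((∀ j, α j) → ℂ) :=
  ∑ i, (LinearMap.lcomp ℂ _ ((extendLocal (N i) (W i)).subtype ∘ₗ LinearMap.proj i)) ∘ₗ
    localOp (N i) ∘ₗ LinearMap.proj i

theorem range_localSumMap (W : ∀ i, Submodule ℂ ((∀ j : N i, α j) → ℂ))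
    (X : ∀ i, ((∀ j : N i, α j) → ℂ) →ₗ[ℂ] ((∀ j : N i, α j) → ℂ)) :
    LinearMap.range (localSumMap N W X) = ⨆ i, extendLocal (N i) ((W i).map (X i)) := by
  have h1 : localSumMap N W X = ∑ i, (localOp (N i) (X i) ∘ₗ (extendLocal (N i) (W i)).subtype) ∘ₗ
      LinearMap.proj i := by
    simp only [localSumMap, LinearMap.sum_apply]
    rfl
  rw [h1, range_sum_comp_proj]
  refine iSup_congr fun i => ?_
  rw [LinearMap.range_comp, Submodule.range_subtype, extendLocal_map]

end LocalSum

/-! ### Achievable relative dimensions -/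

section Achieves

variable {V Q : Type*} [Fintype Q] [DecidableEq Q] {N : V → Finset Q}

/-- The extension of a subspace of the space of the qudits in `S` to all qudits. -/
abbrev extendQudits (d : Q → ℕ) (S : Finset Q) (L : Submodule ℂ (QuditSpace d S)) :
    Submodule ℂ (TotalSpace d) :=
  extendLocal (α := fun j => Fin (d j)) S L

/-- Some local subspaces of relative dimensions at most `ρ i` have extensions whose sum has relative
dimension at least `c`. -/
def Achieves (N : V → Finset Q) (d : Q → ℕ) (ρ : V → ℚ) (c : ℚ) : Prop :=
  ∃ L : ∀ i, Submodule ℂ (QuditSpace d (N i)), (∀ i, relDim (L i) ≤ ρ i) ∧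
    c ≤ relDim (⨆ i, extendQudits d (N i) (L i))

theorem Achieves.mono {d : Q → ℕ} {ρ ρ' : V → ℚ} {c c' : ℚ} (h : Achieves N d ρ c)
    (hρ : ∀ i, ρ i ≤ ρ' i) (hc : c' ≤ c) : Achieves N d ρ' c' := by
  obtain ⟨L, hL, hLc⟩ := h
  exact ⟨L, fun i => (hL i).trans (hρ i), hc.trans hLc⟩

theorem achieves_zero (N : V → Finset Q) (d : Q → ℕ) {ρ : V → ℚ} (hρ : ∀ i, 0 ≤ ρ i) :
    Achieves N d ρ 0 :=
  ⟨fun _ => ⊥, fun i => by simpa [relDim] using hρ i, relDim_nonneg _⟩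

theorem relDim_le_relDim_iff {H : Type*} [AddCommGroup H] [Module ℂ H] [FiniteDimensional ℂ H]
    {W W' : Submodule ℂ H} : relDim W ≤ relDim W' ↔ finrank ℂ W ≤ finrank ℂ W' := by
  unfold relDim
  rcases Nat.eq_zero_or_pos (finrank ℂ H) with h | h
  · have h1 := Submodule.finrank_le W
    have h2 := Submodule.finrank_le W'
    simp [show finrank ℂ W = 0 by omega, show finrank ℂ W' = 0 by omega]
  · rw [div_le_div_iff_of_pos_right (by exact_mod_cast h), Nat.cast_le]

/-- Vertices failing `p` are forced to use one subspace for all `t`. Each original family is an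
operator specialisation of a common reference family, and one generic choice of operators is at
least as good as each specialisation. -/
theorem exists_common_local {τ : Type*} [Fintype V] [Finite τ] [Nonempty τ] (N : V → Finset Q) (d : Q → ℕ)
    (p : V → Prop) (L : τ → ∀ i, Submodule ℂ (QuditSpace d (N i))) :
    ∃ L' : τ → ∀ i, Submodule ℂ (QuditSpace d (N i)),
      (∀ i, p i → ∀ t, L' t i = L t i) ∧ (∀ i, ¬ p i → ∀ t t', L' t i = L' t' i) ∧
      (∀ i, ¬ p i → ∀ t, ∃ t', relDim (L' t i) ≤ relDim (L t' i)) ∧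
      ∀ t, relDim (⨆ i, extendQudits d (N i) (L t i)) ≤
        relDim (⨆ i, extendQudits d (N i) (L' t i)) := by
  classical
  -- The largest of the subspaces at `i` serves as reference: all the others are images of it.
  choose m hm using fun i => Finite.exists_max fun t => finrank ℂ (L t i)
  choose X hX using fun t i => exists_map_eq_of_finrank_le (hm i t)
  let W : τ → ∀ i, Submodule ℂ (QuditSpace d (N i)) :=
    fun t i => if p i then L t i else L (m i) i
  let Y : (∀ i, QuditSpace d (N i) →ₗ[ℂ] QuditSpace d (N i)) →
      ∀ i, QuditSpace d (N i) →ₗ[ℂ] QuditSpace d (N i) :=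
    fun X i => if p i then LinearMap.id else X i
  have hY : ∀ X X' (s : ℂ), Y (X + s • (X' - X)) = Y X + s • (Y X' - Y X) := by
    intro X X' s
    funext i
    by_cases hi : p i <;> simp [Y, hi]
  let T : ∀ t, (∀ i, QuditSpace d (N i) →ₗ[ℂ] QuditSpace d (N i)) →
      (∀ i, extendQudits d (N i) (W t i)) →ₗ[ℂ] TotalSpace d :=
    fun t X => localSumMap (α := fun j => Fin (d j)) N (W t) (Y X)
  have hT : ∀ t X X' (s : ℂ), T t (X + s • (X' - X)) = T t X + s • (T t X' - T t X) := by
    intro t X X' s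
    simp only [T, hY, map_add, map_smul, map_sub]
  obtain ⟨Z, hZ⟩ := exists_common_generic_rank T hT X
  have hrange : ∀ t X, LinearMap.range (T t X) =
      ⨆ i, extendQudits d (N i) (if p i then L t i else (L (m i) i).map (X i)) := by
    intro t X
    rw [show T t X = localSumMap (α := fun j => Fin (d j)) N (W t) (Y X) from rfl,
      range_localSumMap]
    refine iSup_congr fun i => ?_
    by_cases hi : p i <;> simp [W, Y, hi]
  refine ⟨fun t i => if p i then L t i else (L (m i) i).map (Z i), fun i hi t => by simp [hi],
    fun i hi t t' => by simp [hi], fun i hi t => ⟨m i, ?_⟩, fun t => ?_⟩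
  · simp only [hi, if_false]
    rw [relDim_le_relDim_iff]
    exact Submodule.finrank_map_le _ _
  · rw [relDim_le_relDim_iff, ← hrange]
    refine le_trans (le_of_eq ?_) (hZ t)
    rw [hrange]
    refine congrArg (fun W : Submodule ℂ (TotalSpace d) => finrank ℂ W) (iSup_congr fun i => ?_)
    by_cases hi : p i <;> simp [hi, hX]

theorem sum_pi_apply_div_card {ι : Type*} [Fintype ι] [DecidableEq ι] {β : ι → Type*}
    [∀ i, Fintype (β i)] [∀ i, Nonempty (β i)] (k : ι) (g : β k → ℚ) :
    (∑ b : ∀ i, β i, g (b k)) / Fintype.card (∀ i, β i) = (∑ t, g t) / Fintype.card (β k) := by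
  have h1 : ∑ b : ∀ i, β i, g (b k) =
      Fintype.card (∀ i : {i // i ≠ k}, β i) * ∑ t, g t := by
    rw [← Equiv.sum_comp (Equiv.piSplitAt k β).symm, Fintype.sum_prod_type]
    simp [Equiv.piSplitAt, Finset.mul_sum]
  rw [h1, Fintype.card_congr (Equiv.piSplitAt k β), Fintype.card_prod, Nat.cast_mul,
    mul_comm (Fintype.card (β k) : ℚ)]
  exact mul_div_mul_left _ _ (Nat.cast_ne_zero.2 Fintype.card_ne_zero)

/-- The extra factor of qudit `j` labels blocks, in which different instances are used, and relative
dimensions average over blocks. Vertices not touching `j` cannot see the label, hence `hρ` and the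
passage to common subspaces. -/
theorem Achieves.split [Fintype V] {d e : Q → ℕ} (he : ∀ k, 0 < e k) (j : Q) {ρ : Fin (e j) → V → ℚ}
    {c : Fin (e j) → ℚ} (hρ : ∀ i, j ∉ N i → ∀ t t', ρ t i = ρ t' i)
    (h : ∀ t, Achieves N d (ρ t) (c t)) :
    Achieves N (fun k => e k * d k) (fun i => (∑ t, ρ t i) / e j) ((∑ t, c t) / e j) := by
  have hne : ∀ k, Nonempty (Fin (e k)) := fun k => ⟨⟨0, he k⟩⟩
  choose L hL hLc using h
  obtain ⟨L', h1, h2, h3, h4⟩ := exists_common_local N d (fun i => j ∈ N i) L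
  have hρ' : ∀ t i, relDim (L' t i) ≤ ρ t i := by
    intro t i
    by_cases hi : j ∈ N i
    · rw [h1 i hi]; exact hL t i
    · obtain ⟨t', ht'⟩ := h3 i hi t
      exact ht'.trans ((hL t' i).trans_eq (hρ i hi _ _))
  let t₀ : Fin (e j) := ⟨0, he j⟩
  let M : ∀ i, (∀ k : N i, Fin (e k)) → Submodule ℂ (QuditSpace d (N i)) :=
    fun i b => L' (if hi : j ∈ N i then b ⟨j, hi⟩ else t₀) i
  let E : ∀ k, Fin (e k * d k) ≃ Fin (e k) × Fin (d k) := fun k => finProdFinEquiv.symm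
  refine ⟨fun i => blockSubmodule (splitSites fun k : N i => E k) (M i), fun i => ?_, ?_⟩
  · rw [relDim_blockSubmodule]
    by_cases hi : j ∈ N i
    · have h5 := sum_pi_apply_div_card (β := fun k : N i => Fin (e k)) ⟨j, hi⟩
        (fun t => relDim (L' t i))
      simp only [M, hi, dif_pos]
      rw [h5, Fintype.card_fin]
      gcongr with t
      exact hρ' t i
    · simp only [M, hi, dif_neg, not_false_iff]
      have hc : (Fintype.card (∀ k : N i, Fin (e k)) : ℚ) ≠ 0 :=
        Nat.cast_ne_zero.2 Fintype.card_ne_zero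
      have he0 : (e j : ℚ) ≠ 0 := Nat.cast_ne_zero.2 (he j).ne'
      rw [Finset.sum_const, Finset.card_univ, nsmul_eq_mul, mul_div_cancel_left₀ _ hc,
        Finset.sum_congr rfl fun t _ => hρ i hi t t₀, Finset.sum_const, Finset.card_univ,
        Fintype.card_fin, nsmul_eq_mul, mul_div_cancel_left₀ _ he0]
      exact hρ' t₀ i
  · have hM : ∀ (i : V) (b : ∀ k, Fin (e k)), M i (fun k => b k) = L' (b j) i := by
      intro i b
      by_cases hi : j ∈ N i
      · simp [M, hi]
      · exact h2 i hi _ _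
    have h5 : blockSubmodule (splitSites E) (fun b => ⨆ i, extendQudits d (N i) (L' (b j) i)) ≤
        ⨆ i, extendLocal (N i) (blockSubmodule (splitSites fun k : N i => E k) (M i)) := by
      refine (blockSubmodule_iSup_le _ _).trans (iSup_mono fun i => ?_)
      simp only [← hM]
      exact blockSubmodule_extendLocal_le E (N i) (M i)
    refine le_trans ?_ (relDim_mono h5)
    rw [relDim_blockSubmodule, sum_pi_apply_div_card (β := fun k => Fin (e k)) j
      (fun t => relDim (⨆ i, extendQudits d (N i) (L' t i))), Fintype.card_fin]
    gcongr with t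
    exact (hLc t).trans (h4 t)

theorem Achieves.enlarge [Fintype V] {d e : Q → ℕ} (he : ∀ k, 0 < e k) {ρ : V → ℚ} {c : ℚ}
    (h : Achieves N d ρ c) : Achieves N (fun k => e k * d k) ρ c := by
  rcases isEmpty_or_nonempty Q with hQ | ⟨⟨j⟩⟩
  · rwa [Subsingleton.elim (fun k => e k * d k) d]
  · have he0 : (e j : ℚ) ≠ 0 := Nat.cast_ne_zero.2 (he j).ne'
    have := Achieves.split he j (ρ := fun _ => ρ) (c := fun _ => c) (fun _ _ _ _ => rfl)
      (fun _ => h)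
    simpa [mul_div_cancel_left₀ _ he0] using this

/-- Brings finitely many instances to one common dimension vector, as splitting requires. -/
theorem Achieves.prod [Fintype V] {κ : Type*} [DecidableEq κ] {K : Finset κ} {d : κ → Q → ℕ}
    (hd : ∀ i ∈ K, ∀ k, 0 < d i k) {ρ : V → ℚ} {c : ℚ} {i : κ} (hi : i ∈ K)
    (h : Achieves N (d i) ρ c) : Achieves N (fun k => ∏ i ∈ K, d i k) ρ c := by
  have h1 := h.enlarge (e := fun k => ∏ i ∈ K.erase i, d i k)
    (fun k => Finset.prod_pos fun i hi => hd i (Finset.mem_of_mem_erase hi) k)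
  simpa only [Finset.prod_erase_mul _ _ hi] using h1

end Achieves

/-! ### Cliques and denominators in the independence polynomial -/

section Denominators

variable {V : Type*} [DecidableEq V]

/-- An independent set meets a clique in at most one vertex. -/
theorem indepPolyOn_sub_clique {R : Type*} [CommRing R] (G : SimpleGraph V) (r : V → R)
    {S K : Finset V} (hKS : K ⊆ S) (hK : ∀ i ∈ K, ∀ k ∈ K, i ≠ k → G.Adj i k) :
    indepPolyOn G r S = indepPolyOn G r (S \ K) -
      ∑ i ∈ K, r i * indepPolyOn G r (nonNbrs G i (S.erase i)) := by
  induction K using Finset.induction_on with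
  | empty => simp
  | insert a K ha ih =>
    rw [ih (fun i hi => hKS (Finset.mem_insert_of_mem hi))
      (fun i hi k hk => hK i (Finset.mem_insert_of_mem hi) k (Finset.mem_insert_of_mem hk)),
      Finset.sum_insert ha]
    have haS : a ∈ S \ K := Finset.mem_sdiff.2 ⟨hKS (Finset.mem_insert_self a K), ha⟩
    have h1 : (S \ K).erase a = S \ insert a K := by
      ext x; simp only [Finset.mem_erase, Finset.mem_sdiff, Finset.mem_insert]; tauto
    have h2 : nonNbrs G a (S \ insert a K) = nonNbrs G a (S.erase a) := by
      ext x
      simp only [mem_nonNbrs, Finset.mem_erase, Finset.mem_sdiff, Finset.mem_insert, not_or]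
      refine ⟨fun h => ⟨⟨h.1.2.1, h.1.1⟩, h.2⟩, fun h => ⟨⟨h.1.2, h.1.1, fun hx => ?_⟩, h.2⟩⟩
      exact h.2 (hK a (Finset.mem_insert_self a K) x (Finset.mem_insert_of_mem hx) (Ne.symm h.1.1))
    rw [indepPolyOn_eq_sub G r haS, h1, h2]
    ring

theorem exists_int_prod_den_mul_indepPolyOn (G : SimpleGraph V) (r : V → ℚ) {S T : Finset V}
    (hT : T ⊆ S) : ∃ z : ℤ, ((∏ i ∈ S, (r i).den : ℕ) : ℚ) * indepPolyOn G r T = z := by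
  classical
  have key : ∀ A ⊆ S, ∃ z : ℤ, ((∏ i ∈ S, (r i).den : ℕ) : ℚ) * ∏ v ∈ A, r v = z := by
    intro A hA
    refine ⟨(∏ i ∈ S \ A, ((r i).den : ℤ)) * ∏ v ∈ A, (r v).num, ?_⟩
    push_cast
    rw [← Finset.prod_sdiff hA, mul_assoc, ← Finset.prod_mul_distrib]
    congr 1
    exact Finset.prod_congr rfl fun v _ => Rat.den_mul_eq_num (r v)
  have : ∀ A ∈ T.powerset, ∃ z : ℤ, ((∏ i ∈ S, (r i).den : ℕ) : ℚ) *
      (if G.IsIndepSet (A : Set V) then (-1) ^ A.card * ∏ v ∈ A, r v else 0) = z := by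
    intro A hA
    obtain ⟨z, hz⟩ := key A ((Finset.mem_powerset.1 hA).trans hT)
    split_ifs
    · refine ⟨(-1) ^ A.card * z, ?_⟩
      push_cast at hz ⊢
      rw [← hz]; ring
    · exact ⟨0, by simp⟩
  choose! z hz using this
  refine ⟨∑ A ∈ T.powerset, z A, ?_⟩
  rw [indepPolyOn, Finset.mul_sum, Int.cast_sum]
  exact Finset.sum_congr rfl fun A hA => by rw [← hz A hA]

theorem exists_nat_prod_den_mul_indepPolyOn (G : SimpleGraph V) (r : V → ℚ) {S T : Finset V}
    (hT : T ⊆ S) (h0 : 0 ≤ indepPolyOn G r T) :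
    ∃ n : ℕ, ((∏ i ∈ S, (r i).den : ℕ) : ℚ) * indepPolyOn G r T = n := by
  obtain ⟨z, hz⟩ := exists_int_prod_den_mul_indepPolyOn G r hT
  have : 0 ≤ z := by
    have h1 : (0 : ℚ) ≤ z := hz ▸ mul_nonneg (Nat.cast_nonneg _) h0
    exact_mod_cast h1
  lift z to ℕ using this
  exact ⟨z, by simpa using hz⟩

/-- Distributes blocks among the members of a clique, up to `n i` for `i`, until none remain. The
truncated subtraction covers both regimes, blocks left over or demand exceeding supply. -/
theorem exists_labels {τ : Type*} [Fintype τ] (K : Finset V) (n : V → ℕ) :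
    ∃ l : τ → Option V, (∀ t i, l t = some i → i ∈ K) ∧
      (∀ i, (Finset.univ.filter fun t => l t = some i).card ≤ n i) ∧
      (Finset.univ.filter fun t => l t = none).card = Fintype.card τ - ∑ i ∈ K, n i := by
  classical
  induction K using Finset.induction_on with
  | empty => exact ⟨fun _ => none, by simp⟩
  | insert a K ha ih =>
    obtain ⟨l, h1, h2, h3⟩ := ih
    obtain ⟨A, hA, hAc⟩ := Finset.exists_subset_card_eq
      (min_le_right (n a) (Finset.univ.filter fun t => l t = none).card)
    have hA' : ∀ t ∈ A, l t = none := fun t ht => by simpa using hA ht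
    refine ⟨fun t => if t ∈ A then some a else l t, fun t i => ?_, fun i => ?_, ?_⟩
    · beta_reduce
      split_ifs
      · rintro ⟨⟩; exact Finset.mem_insert_self a K
      · exact fun h => Finset.mem_insert_of_mem (h1 t i h)
    · by_cases hi : i = a
      · subst hi
        refine le_trans (Finset.card_le_card (t := A) fun t ht => ?_) (hAc.trans_le (min_le_left _ _))
        by_contra htA
        simp only [Finset.mem_filter, Finset.mem_univ, true_and, if_neg htA] at ht
        exact ha (h1 t i ht)
      · refine le_trans (Finset.card_le_card fun t ht => ?_) (h2 i)
        simp only [Finset.mem_filter, Finset.mem_univ, true_and] at ht ⊢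
        by_cases htA : t ∈ A
        · rw [if_pos htA] at ht
          exact absurd (Option.some_injective _ ht).symm hi
        · rwa [if_neg htA] at ht
    · have : (Finset.univ.filter fun t => (if t ∈ A then some a else l t) = none) =
          (Finset.univ.filter fun t => l t = none) \ A := by
        ext t
        simp only [Finset.mem_filter, Finset.mem_univ, true_and, Finset.mem_sdiff]
        by_cases htA : t ∈ A <;> simp [htA]
      rw [this, Finset.card_sdiff_of_subset hA, hAc, h3, Finset.sum_insert ha]
      omega

/-- The function `r` on `S`, extended by zero. -/
def restrictTo (S : Finset V) (r : V → ℚ) : V → ℚ := fun k => if k ∈ S then r k else 0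

end Denominators

/-! ### The recursion through one shared qudit -/

section Recursion

variable {V Q : Type*} [DecidableEq V] [Fintype V] [Fintype Q] [DecidableEq Q] {N : V → Finset Q}

/-- In a block labelled `i` only `i` among `K` is active, with budget `r' i`, and the space is
filled; unlabelled blocks reach `c₀` without `K`. By `hn`, the blocks of `i` cost it at most `r i`
on average. -/
theorem Achieves.split_clique {d : Q → ℕ} {S : Finset V} {j : Q} {K : Finset V}
    (hK : K = S.filter fun i => j ∈ N i) {M : ℕ} (hM : 0 < M) {n : V → ℕ} {r r' : V → ℚ}
    {c₀ : ℚ} (hr' : ∀ i ∈ K, 0 ≤ r' i)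
    (hn : ∀ i ∈ K, n i * r' i ≤ M * r i)
    (hA : ∀ i ∈ K, Achieves N d (Function.update (restrictTo (S \ K) r) i (r' i)) 1)
    (h₀ : Achieves N d (restrictTo (S \ K) r) c₀) :
    Achieves N (fun k => (if k = j then M else 1) * d k) (restrictTo S r)
      (1 - ((M - ∑ i ∈ K, n i : ℕ) : ℚ) / M * (1 - c₀)) := by
  set e : Q → ℕ := fun k => if k = j then M else 1 with he
  have hej : e j = M := by simp [he]
  have hepos : ∀ k, 0 < e k := fun k => by
    simp only [he]; split_ifs; exacts [hM, one_pos]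
  obtain ⟨l, h1, h2, h3⟩ := exists_labels (τ := Fin (e j)) K n
  replace h3 := h3.trans (by rw [Fintype.card_fin, hej] : _ = M - ∑ i ∈ K, n i)
  set ρ : Fin (e j) → V → ℚ := fun t => (l t).elim (restrictTo (S \ K) r)
    (fun i => Function.update (restrictTo (S \ K) r) i (r' i)) with hρ
  set c : Fin (e j) → ℚ := fun t => if l t = none then c₀ else 1 with hc
  have hρK : ∀ i, i ∉ K → ∀ t, ρ t i = restrictTo (S \ K) r i := by
    intro i hi t
    simp only [hρ]
    rcases hl : l t with _ | k
    · rfl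
    · have : i ≠ k := fun h => hi (h ▸ h1 t k hl)
      simp [Function.update_of_ne this]
  have hconst : ∀ i, j ∉ N i → ∀ t t', ρ t i = ρ t' i := by
    intro i hi t t'
    have hiK : i ∉ K := fun h => hi (by rw [hK] at h; exact (Finset.mem_filter.1 h).2)
    rw [hρK i hiK, hρK i hiK]
  have hach : ∀ t, Achieves N d (ρ t) (c t) := by
    intro t
    simp only [hρ, hc]
    rcases hl : l t with _ | k
    · simpa using h₀
    · simpa using hA k (h1 t k hl)
  have hsplit := Achieves.split hepos j hconst hach
  have hMq : (0 : ℚ) < M := by exact_mod_cast hM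
  have hejq : (e j : ℚ) = M := by rw [hej]
  refine hsplit.mono (fun i => ?_) (le_of_eq ?_)
  · rw [hejq, div_le_iff₀ hMq]
    by_cases hi : i ∈ K
    · have hiS : i ∈ S := by rw [hK] at hi; exact (Finset.mem_filter.1 hi).1
      have h4 : ∀ t, ρ t i = if l t = some i then r' i else 0 := by
        intro t
        simp only [hρ]
        rcases hl : l t with _ | k
        · simp [restrictTo, hi]
        · by_cases hki : k = i
          · subst hki; simp
          · simp [hki, Function.update_of_ne (Ne.symm hki), restrictTo, hi]
      simp only [h4, restrictTo, if_pos hiS]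
      rw [← Finset.sum_filter, Finset.sum_const, nsmul_eq_mul, mul_comm (r i)]
      refine le_trans ?_ (hn i hi)
      exact mul_le_mul_of_nonneg_right (by exact_mod_cast h2 i) (hr' i hi)
    · rw [Finset.sum_congr rfl fun t _ => hρK i hi t, Finset.sum_const, Finset.card_univ,
        Fintype.card_fin, nsmul_eq_mul, hejq, mul_comm]
      refine mul_le_mul_of_nonneg_right ?_ hMq.le
      simp only [restrictTo, Finset.mem_sdiff, hi, not_false_eq_true, and_true, le_refl]
  · have h5 : ∑ t, c t = M - ((M - ∑ i ∈ K, n i : ℕ) : ℚ) * (1 - c₀) := by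
      have : ∀ t, c t = 1 - if l t = none then 1 - c₀ else 0 := fun t => by
        simp only [hc]; split_ifs <;> ring
      simp only [this]
      rw [Finset.sum_sub_distrib, ← Finset.sum_filter, Finset.sum_const, Finset.sum_const, h3,
        Finset.card_univ, nsmul_eq_mul, nsmul_eq_mul, Fintype.card_fin, hejq, mul_one]
    rw [h5, hejq]
    field_simp

theorem Rat.den_natCast_div_le (a : ℕ) {b : ℕ} (hb : 0 < b) : ((a : ℚ) / b).den ≤ b := by
  have h : ((((a : ℤ) : ℚ) / ((b : ℤ) : ℚ)).den : ℤ) ∣ b := by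
    rw [← Rat.divInt_eq_div]; exact Rat.den_dvd a b
  simp only [Int.cast_natCast, Int.natCast_dvd_natCast] at h
  exact Nat.le_of_dvd hb h

theorem depGraph_adj_of_mem {V Q : Type*} [DecidableEq Q] {N : V → Finset Q} {i k : V} {j : Q} (hik : i ≠ k) (hi : j ∈ N i) (hk : j ∈ N k) :
    (depGraph N).Adj i k := ⟨hik, j, Finset.mem_inter.2 ⟨hi, hk⟩⟩

/-- The common step of both constructions. The filling statement enters as the hypothesis `hA`,
which is an induction hypothesis in one use and an established result in the other; its cardinality
condition makes `T` smaller than `S` once `K` has two elements. -/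
theorem achieves_step {S : Finset V} {r : V → ℚ} (hr : ∀ i, 0 ≤ r i) {j : Q} {K : Finset V}
    (hK : K = S.filter fun i => j ∈ N i) (hKne : K.Nonempty)
    (hpos : ∀ A, A ⊂ S → 0 < indepPolyOn (depGraph N) r A)
    (hA : ∀ (T : Finset V) (ρ : V → ℚ), T.card + K.card ≤ S.card + 1 → (∀ i, 0 ≤ ρ i) →
      (∀ A, A ⊂ T → 0 < indepPolyOn (depGraph N) ρ A) → indepPolyOn (depGraph N) ρ T ≤ 0 →
      ∃ d : Q → ℕ, (∀ k, 0 < d k ∧ d k ≤ (∏ i ∈ T, (ρ i).den) ^ (4 ^ (T.card - 1) - 1)) ∧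
        Achieves N d (restrictTo T ρ) 1)
    {d₀ : Q → ℕ} {b : ℕ} {c₀ : ℚ} (hd₀ : ∀ k, 0 < d₀ k ∧ d₀ k ≤ b)
    (h₀ : Achieves N d₀ (restrictTo (S \ K) r) c₀) :
    ∃ d : Q → ℕ, (∀ k, 0 < d k ∧ d k ≤ (∏ i ∈ S, (r i).den) ^
        (1 + 2 * K.card * (4 ^ (S.card - K.card) - 1)) * b) ∧
      Achieves N d (restrictTo S r)
        (1 - max 0 (indepPolyOn (depGraph N) r S / indepPolyOn (depGraph N) r (S \ K)) *
          (1 - c₀)) := by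
  set G := depGraph N with hG
  have hKS : K ⊆ S := by rw [hK]; exact Finset.filter_subset _ _
  have hKc : ∀ i ∈ K, ∀ k ∈ K, i ≠ k → G.Adj i k := fun i hi k hk hik => by
    rw [hK, Finset.mem_filter] at hi hk
    exact depGraph_adj_of_mem hik hi.2 hk.2
  have hss : S \ K ⊂ S := Finset.sdiff_ssubset hKS hKne
  have hI := hpos _ hss
  set P : V → Finset V := fun i => nonNbrs G i (S.erase i) with hP
  have hPsub : ∀ i ∈ K, P i ⊆ S \ K := by
    intro i hi x hx
    simp only [hP, mem_nonNbrs, Finset.mem_erase] at hx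
    exact Finset.mem_sdiff.2 ⟨hx.1.2, fun hxK => hx.2 (hKc i hi x hxK (Ne.symm hx.1.1))⟩
  have hPpos : ∀ i ∈ K, 0 < indepPolyOn G r (P i) := fun i hi =>
    hpos _ ((hPsub i hi).trans_ssubset hss)
  have hle1 : ∀ A, A ⊂ S → indepPolyOn G r A ≤ 1 := fun A hAS =>
    indepPolyOn_le_one G (fun v _ => hr v) fun B hB => hpos B (hB.trans hAS)
  set r' : V → ℚ := fun i => indepPolyOn G r (S \ K) / indepPolyOn G r (P i) with hr'
  have hr'pos : ∀ i ∈ K, 0 < r' i := fun i hi => div_pos hI (hPpos i hi)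
  set D' := ∏ i ∈ S \ K, (r i).den with hD'
  set D := ∏ i ∈ S, (r i).den with hD
  have hD'pos : 0 < D' := Finset.prod_pos fun i _ => (r i).den_pos
  have hDpos : 0 < D := Finset.prod_pos fun i _ => (r i).den_pos
  have hD'D : D' ≤ D := Finset.prod_le_prod_of_subset_of_one_le' hss.subset
    fun i _ _ => (r i).den_pos
  -- Multiplying both I(S \ K) and I(P i) by `D'` writes `r' i` as a quotient of integers, with
  -- denominator at most `D'` because I(P i) ≤ 1.
  have hden : ∀ i ∈ K, (r' i).den ≤ D' := by
    intro i hi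
    obtain ⟨a, ha⟩ := exists_nat_prod_den_mul_indepPolyOn G r (Finset.Subset.refl (S \ K)) hI.le
    obtain ⟨q, hq⟩ := exists_nat_prod_den_mul_indepPolyOn G r (hPsub i hi) (hPpos i hi).le
    rw [← hD'] at ha hq
    have hD'q : (0 : ℚ) < D' := by exact_mod_cast hD'pos
    have hqpos : 0 < q := by
      have : (0 : ℚ) < q := hq ▸ mul_pos hD'q (hPpos i hi)
      exact_mod_cast this
    have hqD : q ≤ D' := by
      have : (q : ℚ) ≤ D' := by
        rw [← hq]
        exact mul_le_of_le_one_right hD'q.le (hle1 _ ((hPsub i hi).trans_ssubset hss))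
      exact_mod_cast this
    have : r' i = (a : ℚ) / q := by
      rw [← ha, ← hq, mul_div_mul_left _ _ hD'q.ne']
    rw [this]
    exact (Rat.den_natCast_div_le a hqpos).trans hqD
  -- With M = D · I(S \ K) blocks, the share M · r_i / r'_i of vertex `i` is the integer D · r_i ·
  -- I(P i), and M ≤ D.
  obtain ⟨M, hM⟩ := exists_nat_prod_den_mul_indepPolyOn G r hss.subset hI.le
  rw [← hD] at hM
  have hDq : (0 : ℚ) < D := by exact_mod_cast hDpos
  have hMpos : 0 < M := by
    have : (0 : ℚ) < M := hM ▸ mul_pos hDq hI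
    exact_mod_cast this
  have hMD : M ≤ D := by
    have : (M : ℚ) ≤ D := by
      rw [← hM]; exact mul_le_of_le_one_right hDq.le (hle1 _ hss)
    exact_mod_cast this
  have hn : ∀ i ∈ K, ∃ n : ℕ, (n : ℚ) = D * (r i * indepPolyOn G r (P i)) := by
    intro i hi
    have hiS := hKS hi
    have hiP : i ∉ P i := fun h => (Finset.mem_sdiff.1 (hPsub i hi h)).2 hi
    have hPP : nonNbrs G i (P i) = P i := by
      ext x; simp [hP]
    have h1 : P i ⊆ S := (hPsub i hi).trans hss.subset
    -- Integrality follows from r_i I(P i) = I(P i) - I(P i + i), since `D` clears both terms.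
    obtain ⟨x, hx⟩ := exists_int_prod_den_mul_indepPolyOn G r h1
    obtain ⟨y, hy⟩ := exists_int_prod_den_mul_indepPolyOn G r
      (Finset.insert_subset hiS h1)
    rw [indepPolyOn_insert G r hiP, hPP] at hy
    rw [← hD] at hx hy
    have hxy : ((x - y : ℤ) : ℚ) = D * (r i * indepPolyOn G r (P i)) := by
      push_cast; rw [← hx, ← hy]; ring
    have h0 : 0 ≤ x - y := by
      have : (0 : ℚ) ≤ ((x - y : ℤ) : ℚ) := by
        rw [hxy]; exact mul_nonneg hDq.le (mul_nonneg (hr i) (hPpos i hi).le)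
      exact_mod_cast this
    obtain ⟨n, hn⟩ := Int.eq_ofNat_of_zero_le h0
    exact ⟨n, by rw [← hxy, hn]; simp⟩
  choose! n hn using hn
  have hbranch : ∀ i ∈ K, ∃ d : Q → ℕ,
      (∀ k, 0 < d k ∧ d k ≤ D ^ (2 * (4 ^ (S.card - K.card) - 1))) ∧
      Achieves N d (Function.update (restrictTo (S \ K) r) i (r' i)) 1 := by
    intro i hi
    set ρ := Function.update r i (r' i) with hρ
    have hiSK : i ∉ S \ K := fun h => (Finset.mem_sdiff.1 h).2 hi
    have hρe : ∀ A ⊆ S \ K, indepPolyOn G ρ A = indepPolyOn G r A := fun A hAS =>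
      indepPolyOn_congr G fun v hv => Function.update_of_ne
        (show v ≠ i from fun h => hiSK (h ▸ hAS hv)) _ _
    have hnP : nonNbrs G i (S \ K) = P i := by
      ext x
      have := @hPsub i hi x
      simp only [hP, mem_nonNbrs, Finset.mem_erase, Finset.mem_sdiff] at this ⊢
      refine ⟨fun h => ⟨⟨fun hx => h.1.2 (hx ▸ hi), h.1.1⟩, h.2⟩, fun h => ⟨this h, h.2⟩⟩
    have hI0 : indepPolyOn G ρ (insert i (S \ K)) ≤ 0 := by
      rw [indepPolyOn_insert G ρ hiSK, hnP, hρe _ (Finset.Subset.refl _), hρe _ (hPsub i hi), hρ,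
        Function.update_self, hr', div_mul_cancel₀ _ (hPpos i hi).ne', sub_self]
    -- The new budget may violate positivity already on a smaller set; passing to a minimal one
    -- restores the hypotheses of `hA`.
    obtain ⟨T, hTsub, hT0, hTmin⟩ := exists_minimal_indepPolyOn_nonpos G ρ hI0
    have hcard : T.card + K.card ≤ S.card + 1 := by
      have h1 := Finset.card_le_card hTsub
      rw [Finset.card_insert_of_notMem hiSK] at h1
      have h2 := Finset.card_sdiff_add_card_eq_card hKS
      omega
    have hρ0 : ∀ v, 0 ≤ ρ v := fun v => by
      rw [hρ, Function.update_apply]; split_ifs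
      exacts [(hr'pos i hi).le, hr v]
    obtain ⟨d, hd, hach⟩ := hA T ρ hcard hρ0 hTmin hT0
    refine ⟨d, fun k => ⟨(hd k).1, (hd k).2.trans ?_⟩, hach.mono (fun v => ?_) le_rfl⟩
    · have h1 : ∏ v ∈ T, (ρ v).den ≤ D ^ 2 := by
        calc ∏ v ∈ T, (ρ v).den ≤ ∏ v ∈ insert i (S \ K), (ρ v).den :=
              Finset.prod_le_prod_of_subset_of_one_le' hTsub fun v _ _ => (ρ v).den_pos
          _ = (r' i).den * D' := by
              rw [Finset.prod_insert hiSK, hρ, Function.update_self]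
              congr 1
              exact Finset.prod_congr rfl fun v hv => by
                rw [Function.update_of_ne (show v ≠ i from fun h => hiSK (h ▸ hv))]
          _ ≤ D' * D' := Nat.mul_le_mul_right _ (hden i hi)
          _ ≤ D ^ 2 := by rw [sq]; exact Nat.mul_le_mul hD'D hD'D
      have h2 : 4 ^ (T.card - 1) ≤ 4 ^ (S.card - K.card) :=
        Nat.pow_le_pow_right (by norm_num) (by omega)
      calc (∏ v ∈ T, (ρ v).den) ^ (4 ^ (T.card - 1) - 1) ≤ (D ^ 2) ^ (4 ^ (T.card - 1) - 1) :=
            Nat.pow_le_pow_left h1 _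
        _ ≤ (D ^ 2) ^ (4 ^ (S.card - K.card) - 1) :=
            Nat.pow_le_pow_right (pow_pos hDpos 2) (Nat.sub_le_sub_right h2 1)
        _ = _ := by rw [← pow_mul]
    · simp only [restrictTo, Function.update_apply, hρ]
      by_cases hv : v = i
      · simp only [hv, if_true]
        split_ifs
        exacts [le_rfl, (hr'pos i hi).le]
      · simp only [hv, if_false]
        split_ifs with h1 h2
        · exact le_rfl
        · exact absurd (Finset.mem_of_mem_insert_of_ne (hTsub h1) hv) h2
        · exact hr v
        · exact le_rfl
  choose! dK hdK hachK using hbranch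
  set d₁ : Q → ℕ := fun k => d₀ k * ∏ i ∈ K, dK i k with hd₁
  have hprodpos : ∀ k, 0 < ∏ i ∈ K, dK i k := fun k => Finset.prod_pos fun i hi => (hdK i hi k).1
  have hachK' : ∀ i ∈ K, Achieves N d₁ (Function.update (restrictTo (S \ K) r) i (r' i)) 1 :=
    fun i hi => (Achieves.prod (fun i hi k => (hdK i hi k).1) hi (hachK i hi)).enlarge
      fun k => (hd₀ k).1
  have h₀' : Achieves N d₁ (restrictTo (S \ K) r) c₀ := by
    have := h₀.enlarge hprodpos
    simpa only [hd₁, mul_comm] using this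
  have hnM : ∀ i ∈ K, n i * r' i = M * r i := by
    intro i hi
    rw [hn i hi, ← hM, hr']
    have := (hPpos i hi).ne'
    field_simp
  have hfin := Achieves.split_clique hK hMpos (n := n) (r' := r')
    (fun i hi => (hr'pos i hi).le) (fun i hi => (hnM i hi).le) hachK' h₀'
  · refine ⟨_, fun k => ⟨?_, ?_⟩, hfin.mono (fun _ => le_rfl) (le_of_eq ?_)⟩
    · refine Nat.mul_pos ?_ (Nat.mul_pos (hd₀ k).1 (hprodpos k))
      split_ifs
      exacts [hMpos, one_pos]
    · have h1 : (if k = j then M else 1) ≤ D := by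
        split_ifs
        exacts [hMD, hDpos]
      have h2 : ∏ i ∈ K, dK i k ≤ D ^ (2 * K.card * (4 ^ (S.card - K.card) - 1)) := by
        calc ∏ i ∈ K, dK i k ≤ ∏ i ∈ K, D ^ (2 * (4 ^ (S.card - K.card) - 1)) :=
              Finset.prod_le_prod' fun i hi => (hdK i hi k).2
          _ = _ := by rw [Finset.prod_const, ← pow_mul]; congr 1; ring
      calc (if k = j then M else 1) * (d₀ k * ∏ i ∈ K, dK i k)
          ≤ D * (b * D ^ (2 * K.card * (4 ^ (S.card - K.card) - 1))) :=
            Nat.mul_le_mul h1 (Nat.mul_le_mul (hd₀ k).2 h2)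
        _ = _ := by rw [pow_add, pow_one]; ring
    · congr 2
      have h1 : indepPolyOn G r S = indepPolyOn G r (S \ K) -
          ∑ i ∈ K, r i * indepPolyOn G r (P i) := indepPolyOn_sub_clique G r hKS hKc
      have h2 : ((∑ i ∈ K, n i : ℕ) : ℚ) = D * ∑ i ∈ K, r i * indepPolyOn G r (P i) := by
        rw [Nat.cast_sum, Finset.mul_sum]
        exact Finset.sum_congr rfl hn
      have h3 : (M : ℚ) - (∑ i ∈ K, n i : ℕ) = D * indepPolyOn G r S := by
        rw [h2, ← hM, h1]; ring
      have hMq : (0 : ℚ) < M := by exact_mod_cast hMpos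
      rcases le_total (∑ i ∈ K, n i) M with h | h
      · rw [Nat.cast_sub h, h3, ← hM, mul_div_mul_left _ _ hDq.ne', max_eq_right]
        refine div_nonneg ?_ hI.le
        have h4 : (0 : ℚ) ≤ D * indepPolyOn G r S := by
          rw [← h3, sub_nonneg]; exact_mod_cast h
        exact nonneg_of_mul_nonneg_right h4 hDq
      · rw [Nat.sub_eq_zero_of_le h, max_eq_left]
        · simp
        refine div_nonpos_of_nonpos_of_nonneg ?_ hI.le
        have h4 : D * indepPolyOn G r S ≤ (0 : ℚ) := by
          rw [← h3, sub_nonpos]; exact_mod_cast h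
        exact nonpos_of_mul_nonpos_right h4 hDq

end Recursion

/-! ### Existence of subspaces of large relative dimension, and the upper bound -/

section Bounds

variable {V Q : Type*} [DecidableEq V] [Fintype V] [Fintype Q] [DecidableEq Q] {N : V → Finset Q}

theorem relDim_top {H : Type*} [AddCommGroup H] [Module ℂ H] (h : finrank ℂ H ≠ 0) :
    relDim (⊤ : Submodule ℂ H) = 1 := by
  rw [relDim, finrank_top, div_self (Nat.cast_ne_zero.2 h)]

/-- If two vertices of `S` share a qudit, split on it: as I(S) ≤ 0 no block is left over, so the
trivial `c₀ = 0` in dimension one suffices. If `S` has no edges, some `r i` is at least 1 and the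
whole space may be taken. -/
theorem achieves_one {S : Finset V} {r : V → ℚ} (hr : ∀ i, 0 ≤ r i)
    (hmin : ∀ A, A ⊂ S → 0 < indepPolyOn (depGraph N) r A)
    (hS : indepPolyOn (depGraph N) r S ≤ 0) :
    ∃ d : Q → ℕ, (∀ k, 0 < d k ∧ d k ≤ (∏ i ∈ S, (r i).den) ^ (4 ^ (S.card - 1) - 1)) ∧
      Achieves N d (restrictTo S r) 1 := by
  induction hs : S.card using Nat.strong_induction_on generalizing S r with
  | _ s ih =>
  subst hs
  have hDpos : 0 < ∏ i ∈ S, (r i).den := Finset.prod_pos fun i _ => (r i).den_pos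
  by_cases hadj : ∃ i ∈ S, ∃ k ∈ S, (depGraph N).Adj i k
  · obtain ⟨i, hi, k, hk, hik, j, hj⟩ := hadj
    rw [Finset.mem_inter] at hj
    set K := S.filter fun i => j ∈ N i with hK
    have hiK : i ∈ K := Finset.mem_filter.2 ⟨hi, hj.1⟩
    have hkK : k ∈ K := Finset.mem_filter.2 ⟨hk, hj.2⟩
    have hKcard : 2 ≤ K.card := Finset.one_lt_card.2 ⟨i, hiK, k, hkK, hik⟩
    have hKS : K.card ≤ S.card := Finset.card_le_card (Finset.filter_subset _ _)
    obtain ⟨d, hd, hach⟩ := achieves_step hr hK ⟨i, hiK⟩ hmin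
      (fun T ρ hT hρ hTmin hT0 => ih T.card (by omega) hρ hTmin hT0 rfl)
      (d₀ := fun _ => 1) (b := 1) (c₀ := 0) (fun _ => ⟨one_pos, le_rfl⟩)
      (achieves_zero N _ fun i => by simp only [restrictTo]; split_ifs; exacts [hr i, le_rfl])
    refine ⟨d, fun k => ⟨(hd k).1, (hd k).2.trans ?_⟩, hach.mono (fun _ => le_rfl) ?_⟩
    · rw [mul_one]
      refine Nat.pow_le_pow_right hDpos ?_
      obtain ⟨m, hm⟩ : ∃ m, K.card = m + 2 := ⟨K.card - 2, by omega⟩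
      obtain ⟨l, hl⟩ : ∃ l, S.card = l + m + 2 := ⟨S.card - K.card, by omega⟩
      obtain ⟨x, hx⟩ : ∃ x, 4 ^ l = x + 1 :=
        ⟨4 ^ l - 1, (Nat.sub_add_cancel (Nat.one_le_pow _ _ (by norm_num))).symm⟩
      -- This is 2|K| ≤ 4^(|K| - 1), which needs |K| ≥ 2 and absorbs the cost of the |K| branches.
      have h1 : 2 * (m + 2) ≤ 4 ^ (m + 1) := by
        clear * -
        induction m with
        | zero => norm_num
        | succ m ih => rw [pow_succ]; omega
      have h2 : 4 ^ (S.card - 1) = 4 ^ (m + 1) * (x + 1) := by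
        rw [← hx, ← pow_add]; congr 1; omega
      rw [h2, hm, show S.card - (m + 2) = l by omega, hx, Nat.add_sub_cancel]
      have h3 := Nat.mul_le_mul_right (x + 1) h1
      refine Nat.le_sub_of_add_le ?_
      nlinarith
    · rw [max_eq_left (div_nonpos_of_nonpos_of_nonneg hS
        (hmin _ (Finset.sdiff_ssubset (Finset.filter_subset _ _) ⟨i, hiK⟩)).le)]
      simp
  · push Not at hadj
    obtain ⟨i, hi⟩ : S.Nonempty := by
      rw [Finset.nonempty_iff_ne_empty]
      rintro rfl
      rw [indepPolyOn_empty] at hS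
      linarith
    -- Without edges I(S) = (1 - r_i) I(S - i), and the second factor is positive by minimality.
    have hri : 1 ≤ r i := by
      have h1 : nonNbrs (depGraph N) i (S.erase i) = S.erase i := by
        ext x
        rw [mem_nonNbrs]
        exact and_iff_left_of_imp fun hx => hadj i hi x (Finset.mem_of_mem_erase hx)
      rw [indepPolyOn_eq_sub _ _ hi, h1] at hS
      have h2 := hmin _ (Finset.erase_ssubset hi)
      by_contra! hcon
      nlinarith
    have hne : ∀ j : Q, Nonempty (Fin ((fun _ => 1 : Q → ℕ) j)) := fun j => ⟨0⟩
    have hfin : ∀ S : Finset Q, finrank ℂ (QuditSpace (fun _ => 1) S) ≠ 0 := fun S => by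
      simp
    refine ⟨fun _ => 1, fun k => ⟨one_pos, Nat.one_le_pow _ _ hDpos⟩,
      fun k => if k = i then ⊤ else ⊥, fun k => ?_, ?_⟩
    · by_cases hk : k = i
      · subst hk
        simp only [if_true, restrictTo, if_pos hi]
        exact (relDim_le_one _).trans hri
      · simp only [hk, if_false, restrictTo]
        rw [show relDim (⊥ : Submodule ℂ (QuditSpace (fun _ => 1) (N k))) = 0 by simp [relDim]]
        split_ifs
        exacts [hr k, le_rfl]
    · refine le_trans (le_of_eq ?_) (relDim_mono (le_iSup (fun k => extendQudits (fun _ => 1) (N k)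
        (if k = i then ⊤ else ⊥)) i))
      rw [if_pos rfl]
      rw [relDim_extendLocal, relDim_top (hfin _)]

/-- With `c₀` = 1 - I(S \ K) from induction, the deficit is I(S) / I(S \ K) times I(S \ K). The
exponent now pays for the branches and for the instance on S \ K. -/
theorem achieves_one_sub (hN : ∀ i, (N i).Nonempty) (S : Finset V) {r : V → ℚ} (hr : ∀ i, 0 ≤ r i)
    (hpos : ∀ A, A ⊆ S → 0 < indepPolyOn (depGraph N) r A) :
    ∃ d : Q → ℕ, (∀ k, 0 < d k ∧ d k ≤ (∏ i ∈ S, (r i).den) ^ (4 ^ S.card - 1)) ∧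
      Achieves N d (restrictTo S r) (1 - indepPolyOn (depGraph N) r S) := by
  induction S using Finset.strongInduction with
  | H S ih =>
    have hDpos : 0 < ∏ i ∈ S, (r i).den := Finset.prod_pos fun i _ => (r i).den_pos
    rcases S.eq_empty_or_nonempty with rfl | ⟨i, hi⟩
    · refine ⟨fun _ => 1, by simp, ?_⟩
      rw [indepPolyOn_empty, sub_self]
      exact achieves_zero N _ fun i => by simp [restrictTo]
    obtain ⟨j, hj⟩ := hN i
    set K := S.filter fun i => j ∈ N i with hK
    have hiK : i ∈ K := Finset.mem_filter.2 ⟨hi, hj⟩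
    have hKsub : K ⊆ S := Finset.filter_subset _ _
    have hKcard : 1 ≤ K.card := Finset.card_pos.2 ⟨i, hiK⟩
    have hKS : K.card ≤ S.card := Finset.card_le_card hKsub
    have hss : S \ K ⊂ S := Finset.sdiff_ssubset hKsub ⟨i, hiK⟩
    obtain ⟨d₀, hd₀, hach₀⟩ := ih _ hss fun A hA => hpos A (hA.trans hss.subset)
    have hIK := hpos _ hss.subset
    obtain ⟨d, hd, hach⟩ := achieves_step hr hK ⟨i, hiK⟩ (fun A hA => hpos A hA.subset)
      (fun T ρ _ hρ hTmin hT0 => achieves_one hρ hTmin hT0) hd₀ hach₀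
    refine ⟨d, fun k => ⟨(hd k).1, (hd k).2.trans ?_⟩, hach.mono (fun _ => le_rfl) ?_⟩
    · rw [Finset.card_sdiff_of_subset hKsub]
      have h1 : ∏ i ∈ S \ K, (r i).den ≤ ∏ i ∈ S, (r i).den :=
        Finset.prod_le_prod_of_subset_of_one_le' hss.subset fun i _ _ => (r i).den_pos
      refine (Nat.mul_le_mul_left _ (Nat.pow_le_pow_left h1 _)).trans ?_
      rw [← pow_add]
      refine Nat.pow_le_pow_right hDpos ?_
      obtain ⟨m, hm⟩ : ∃ m, K.card = m + 1 := ⟨K.card - 1, by omega⟩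
      obtain ⟨l, hl⟩ : ∃ l, S.card = l + m + 1 := ⟨S.card - K.card, by omega⟩
      obtain ⟨x, hx⟩ : ∃ x, 4 ^ l = x + 1 :=
        ⟨4 ^ l - 1, (Nat.sub_add_cancel (Nat.one_le_pow _ _ (by norm_num))).symm⟩
      have h1 : 2 * (m + 1) + 1 ≤ 4 ^ (m + 1) := by
        clear * -
        induction m with
        | zero => norm_num
        | succ m ih => rw [pow_succ]; omega
      have h2 : 4 ^ S.card = 4 ^ (m + 1) * (x + 1) := by
        rw [← hx, ← pow_add]; congr 1; omega
      rw [h2, hm, show S.card - (m + 1) = l by omega, hx, Nat.add_sub_cancel]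
      have h3 := Nat.mul_le_mul_right (x + 1) h1
      refine Nat.le_sub_of_add_le ?_
      nlinarith
    · rw [max_eq_right (div_nonneg (hpos S (Finset.Subset.refl S)).le hIK.le), sub_sub_cancel,
        div_mul_cancel₀ _ hIK.ne']

end Bounds

/-! ### Shearer's bound for subspaces -/

section UpperBound

variable {V Q : Type*} [Fintype Q] [DecidableEq Q] {α : Q → Type*}

theorem extendLocal_le_comap_mul {S T : Finset Q} (hST : Disjoint S T)
    (L : Submodule ℂ ((∀ j : T, α j) → ℂ)) (f : (∀ j : S, α j) → ℂ) :
    extendLocal T L ≤ (extendLocal T L).comap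
      (LinearMap.mulLeft ℂ (fun z : ∀ j, α j => f fun j => z j)) := by
  intro g hg y
  have h1 : ∀ x, (fun j : S => (splitConfig α T).symm (y, x) j) =
      fun j : S => y ⟨j, Finset.mem_compl.2 (Finset.disjoint_left.1 hST j.2)⟩ := fun x => by
    ext j; exact splitConfig_symm_of_notMem _ (Finset.disjoint_left.1 hST j.2)
  simp only [LinearMap.mulLeft_apply, Pi.mul_apply, h1]
  exact L.smul_mem _ (hg y)

theorem extendLocal_le_comap_funLeft {S T : Finset Q} (hST : Disjoint S T)
    (L : Submodule ℂ ((∀ j : T, α j) → ℂ)) (x : ∀ j : S, α j) :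
    extendLocal T L ≤ (extendLocal T L).comap
      (LinearMap.funLeft ℂ ℂ fun z : ∀ j, α j =>
        (splitConfig α S).symm ((splitConfig α S z).1, x)) := by
  intro g hg y
  let y' : ∀ j : ↥Tᶜ, α j := fun j =>
    if h : (j : Q) ∈ S then x ⟨j, h⟩ else y j
  have h1 : ∀ a, (splitConfig α S).symm ((splitConfig α S ((splitConfig α T).symm (y, a))).1, x) =
      (splitConfig α T).symm (y', a) := by
    intro a
    funext j
    by_cases hS : j ∈ S
    · have hT : j ∉ T := Finset.disjoint_left.1 hST hS
      rw [splitConfig_symm_of_mem _ hS, splitConfig_symm_of_notMem _ hT]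
      simp [y', hS]
    · rw [splitConfig_symm_of_notMem _ hS]
      change (splitConfig α T).symm (y, a) j = _
      by_cases hT : j ∈ T
      · rw [splitConfig_symm_of_mem _ hT, splitConfig_symm_of_mem _ hT]
      · rw [splitConfig_symm_of_notMem _ hT, splitConfig_symm_of_notMem _ hT]
        simp [y', hS]
  simp only [LinearMap.funLeft_apply, h1]
  exact hg y'

theorem iSup_le_comap_iSup {ι R M : Type*} [Semiring R] [AddCommMonoid M] [Module R M]
    {E : ι → Submodule R M} {f : M →ₗ[R] M} (h : ∀ i, E i ≤ (E i).comap f) :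
    ⨆ i, E i ≤ (⨆ i, E i).comap f :=
  iSup_le fun i => (h i).trans (Submodule.comap_mono (le_iSup E i))

/-- The sum `U` involves only sites outside `S`, so it has the form H_S ⊗ W, and L ⊗ W lies in both
subspaces. This plays the role of independence of non-adjacent events. -/
theorem relDim_mul_relDim_le_inf [∀ j, Fintype (α j)] [∀ j, Nonempty (α j)] {ι : Type*}
    {S : Finset Q} (L : Submodule ℂ ((∀ j : S, α j) → ℂ)) {T : ι → Finset Q}
    (hT : ∀ i, Disjoint S (T i)) (M : ∀ i, Submodule ℂ ((∀ j : T i, α j) → ℂ)) :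
    relDim L * relDim (⨆ i, extendLocal (T i) (M i)) ≤
      relDim (extendLocal S L ⊓ ⨆ i, extendLocal (T i) (M i)) := by
  classical
  set U := ⨆ i, extendLocal (T i) (M i) with hU
  let pull : ((∀ j : ↥Sᶜ, α j) → ℂ) →ₗ[ℂ] ((∀ j, α j) → ℂ) :=
    LinearMap.funLeft ℂ ℂ fun z => (splitConfig α S z).1
  -- Freezing the coordinates in `S` maps `U` to itself, so every slice of a member of `U` lies in
  -- `W`; multiplying by functions of those coordinates brings `W` back into `U`.
  set W : Submodule ℂ ((∀ j : ↥Sᶜ, α j) → ℂ) := U.comap pull with hW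
  have h1 : U ≤ blockSubmodule ((splitConfig α S).trans (Equiv.prodComm _ _)) fun _ => W := by
    intro f hf x
    have := iSup_le_comap_iSup (fun i => extendLocal_le_comap_funLeft (hT i) (M i) x) hf
    exact this
  have h2 : relDim U ≤ relDim W := by
    refine (relDim_mono h1).trans_eq ?_
    exact relDim_blockSubmodule_const _ _
  let b := finBasis ℂ W
  let Φ : (Fin (finrank ℂ W) → L) →ₗ[ℂ] ((∀ j, α j) → ℂ) :=
    ∑ k, LinearMap.mulRight ℂ (pull (b k)) ∘ₗ
      (LinearMap.funLeft ℂ ℂ fun z : ∀ j, α j => (splitConfig α S z).2) ∘ₗ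
        L.subtype ∘ₗ LinearMap.proj k
  have hΦ : ∀ f z, Φ f z = ∑ k, (f k : (∀ j : S, α j) → ℂ) (splitConfig α S z).2 *
      (b k : (∀ j : ↥Sᶜ, α j) → ℂ) (splitConfig α S z).1 := by
    intro f z
    simp only [Φ, LinearMap.sum_apply, Finset.sum_apply]
    rfl
  have hinj : Function.Injective Φ := by
    rw [injective_iff_map_eq_zero]
    intro f hf
    have h3 : ∀ x, ∑ k, (f k : (∀ j : S, α j) → ℂ) x • b k = 0 := by
      intro x
      ext y
      have := congrFun hf ((splitConfig α S).symm (y, x))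
      rw [hΦ] at this
      simpa [Equiv.apply_symm_apply] using this
    funext k
    ext x
    exact Fintype.linearIndependent_iff.1 b.linearIndependent _ (h3 x) k
  have hmem : ∀ f, Φ f ∈ extendLocal S L ⊓ U := by
    intro f
    constructor
    · intro y
      have : (fun x => Φ f ((splitConfig α S).symm (y, x))) =
          ∑ k, (b k : (∀ j : ↥Sᶜ, α j) → ℂ) y • (f k : (∀ j : S, α j) → ℂ) := by
        ext x
        rw [hΦ]
        simp [mul_comm]
      rw [this]
      exact Submodule.sum_mem _ fun k _ => L.smul_mem _ (f k).2
    · have : Φ f = ∑ k, (fun z : ∀ j, α j => (f k : (∀ j : S, α j) → ℂ) fun j => z j) *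
          pull (b k) := by
        ext z
        rw [hΦ, Finset.sum_apply]
        rfl
      rw [this]
      refine Submodule.sum_mem _ fun k _ => ?_
      exact iSup_le_comap_iSup (fun i => extendLocal_le_comap_mul (hT i) (M i) (f k)) (b k).2
  have h3 : finrank ℂ W * finrank ℂ L ≤
      finrank ℂ (extendLocal S L ⊓ U : Submodule ℂ ((∀ j, α j) → ℂ)) := by
    have := LinearMap.finrank_le_finrank_of_injective
      (f := Φ.codRestrict (extendLocal S L ⊓ U) hmem) fun f g hfg => hinj (congrArg Subtype.val hfg)
    rw [finrank_pi_fintype, Finset.sum_const, Finset.card_univ, Fintype.card_fin,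
      smul_eq_mul] at this
    exact this
  refine (mul_le_mul_of_nonneg_left h2 (relDim_nonneg L)).trans ?_
  simp only [relDim, finrank_fintype_fun_eq_card, Fintype.card_congr (splitConfig α S),
    Fintype.card_prod]
  rw [div_mul_div_comm, Nat.cast_mul, mul_comm (Fintype.card (∀ j : S, α j) : ℚ)]
  gcongr
  rw [mul_comm]
  exact_mod_cast h3

theorem relDim_sup_add_inf {H : Type*} [AddCommGroup H] [Module ℂ H] [FiniteDimensional ℂ H]
    (W W' : Submodule ℂ H) : relDim (W ⊔ W') + relDim (W ⊓ W') = relDim W + relDim W' := by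
  unfold relDim
  rw [← add_div, ← add_div]
  congr 1
  exact_mod_cast Submodule.finrank_sup_add_finrank_inf_eq W W'

/-- The dimension formula for V_v + ∑_{i ∈ T} V_i, with `hinf` bounding the intersection from below,
is Shearer's recursive inequality for one minus the relative dimension. -/
theorem relDim_iSup_le_of_inf [Fintype V] [DecidableEq V] {H : Type*} [AddCommGroup H]
    [Module ℂ H] [FiniteDimensional ℂ H] {G : SimpleGraph V} {r : V → ℚ} (hr : ∀ i, 0 ≤ r i)
    (hI : ∀ T, 0 < indepPolyOn G r T) {E : V → Submodule ℂ H} (hE : ∀ i, relDim (E i) ≤ r i)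
    (hinf : ∀ v T, v ∉ T → relDim (E v) * relDim (⨆ i : nonNbrs G v T, E i) ≤
      relDim (E v ⊓ ⨆ i : nonNbrs G v T, E i)) :
    relDim (⨆ i, E i) ≤ 1 - indepPolyOn G r Finset.univ := by
  have hQ : ∀ (v : V) (T : Finset V), v ∉ T → 1 - relDim (⨆ i : T, E i) -
      r v * (1 - relDim (⨆ i : nonNbrs G v T, E i)) ≤
        1 - relDim (⨆ i : (insert v T : Finset V), E i) := by
    intro v T hv
    have h1 : (⨆ i : (insert v T : Finset V), E i) = E v ⊔ ⨆ i : T, E i := by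
      rw [iSup_subtype, iSup_subtype]
      exact Finset.iSup_insert v T E
    have h2 := relDim_sup_add_inf (E v) (⨆ i : T, E i)
    have h4 := hinf v T hv
    have h6 : relDim (E v ⊓ ⨆ i : nonNbrs G v T, E i) ≤ relDim (E v ⊓ ⨆ i : T, E i) := by
      refine relDim_mono (inf_le_inf_left _ (iSup_le fun i => ?_))
      exact le_iSup (fun i : T => E i) ⟨i, nonNbrs_subset _ _ _ i.2⟩
    have h7 := relDim_le_one (⨆ i : nonNbrs G v T, E i)
    have h8 := mul_le_mul_of_nonneg_right (hE v) (sub_nonneg.2 h7)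
    rw [h1]
    linarith
  have key := indepPolyOn_le_of_recursion G hr hI (Q := fun T => 1 - relDim (⨆ i : T, E i))
    (by simp [relDim]) hQ Finset.univ
  have h1 : (⨆ i : (Finset.univ : Finset V), E i) = ⨆ i, E i := by
    rw [iSup_subtype]; simp
  rw [h1] at key
  linarith

theorem relDim_iSup_le_one_sub [Fintype V] [DecidableEq V] {N : V → Finset Q} {d : Q → ℕ}
    (hd : ∀ k, 0 < d k) {r : V → ℚ} (hr : ∀ i, 0 ≤ r i)
    (hI : ∀ T, 0 < indepPolyOn (depGraph N) r T)
    {L : ∀ i, Submodule ℂ (QuditSpace d (N i))} (hL : ∀ i, relDim (L i) ≤ r i) :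
    relDim (⨆ i, extendQudits d (N i) (L i)) ≤ 1 - indepPolyOn (depGraph N) r Finset.univ := by
  have hne : ∀ j, Nonempty (Fin (d j)) := fun j => ⟨⟨0, hd j⟩⟩
  have hEr : ∀ i, relDim (extendQudits d (N i) (L i)) ≤ r i := fun i =>
    (relDim_extendLocal (α := fun j => Fin (d j)) (N i) (L i)).trans_le (hL i)
  have hinf : ∀ v T, v ∉ T →
      relDim (extendQudits d (N v) (L v)) *
        relDim (⨆ i : nonNbrs (depGraph N) v T, extendQudits d (N i) (L i)) ≤
        relDim (extendQudits d (N v) (L v) ⊓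
          ⨆ i : nonNbrs (depGraph N) v T, extendQudits d (N i) (L i)) := by
    intro v T hv
    rw [show relDim (extendQudits d (N v) (L v)) = relDim (L v) from
      relDim_extendLocal (α := fun j => Fin (d j)) (N v) (L v)]
    refine relDim_mul_relDim_le_inf (α := fun j => Fin (d j)) (L v)
      (T := fun i : nonNbrs (depGraph N) v T => N i) (fun i => ?_) fun i => L i
    have h5 := mem_nonNbrs.1 i.2
    rw [Finset.disjoint_iff_inter_eq_empty, ← Finset.not_nonempty_iff_eq_empty]
    exact fun h => h5.2 ⟨fun h => hv (h ▸ h5.1), h⟩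
  exact relDim_iSup_le_of_inf hr hI hEr hinf

end UpperBound

/-! ### Random instances -/

section Random

theorem exists_submodule_finrank_eq {H : Type*} [AddCommGroup H] [Module ℂ H] {k : ℕ}
    (h : k ≤ finrank ℂ H) : ∃ W : Submodule ℂ H, finrank ℂ W = k := by
  obtain ⟨v, hv⟩ := exists_linearIndependent_of_le_finrank h
  exact ⟨Submodule.span ℂ (Set.range v), by rw [finrank_span_eq_card hv, Fintype.card_fin]⟩

/-- An isometry from `L` onto a subspace of `W` of the same dimension extends to the whole space;
its inverse is the unitary. -/
theorem exists_unitary_le_map {ι : Type*} [Fintype ι] [DecidableEq ι] {L W : Submodule ℂ (ι → ℂ)}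
    (h : finrank ℂ L ≤ finrank ℂ W) :
    ∃ u : Matrix.unitaryGroup ι ℂ, L ≤ W.map (Matrix.mulVecLin (u : Matrix ι ι ℂ)) := by
  let e : EuclideanSpace ℂ ι ≃ₗ[ℂ] (ι → ℂ) := WithLp.linearEquiv 2 ℂ (ι → ℂ)
  let L₁ : Submodule ℂ (EuclideanSpace ℂ ι) := L.map e.symm.toLinearMap
  obtain ⟨W', hW'⟩ := exists_submodule_finrank_eq h
  let W₁ : Submodule ℂ (EuclideanSpace ℂ ι) := (W'.map W.subtype).map e.symm.toLinearMap
  have hfin : finrank ℂ L₁ = finrank ℂ W₁ := by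
    rw [LinearEquiv.finrank_map_eq e.symm L, LinearEquiv.finrank_map_eq e.symm,
      Submodule.finrank_map_subtype_eq W W', hW']
  let g : L₁ →ₗᵢ[ℂ] EuclideanSpace ℂ ι := W₁.subtypeₗᵢ.comp
    ((stdOrthonormalBasis ℂ L₁).equiv (stdOrthonormalBasis ℂ W₁) (finCongr hfin)).toLinearIsometry
  let T : EuclideanSpace ℂ ι ≃ₗᵢ[ℂ] EuclideanSpace ℂ ι := g.extend.toLinearIsometryEquiv rfl
  let b := EuclideanSpace.basisFun ι ℂ
  refine ⟨⟨_, T.symm.toMatrix_mem_unitaryGroup b b⟩, fun x hx => ?_⟩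
  have hx₁ : e.symm x ∈ L₁ := Submodule.mem_map_of_mem hx
  have hT : T (e.symm x) ∈ W₁ := by
    have : T (e.symm x) = g ⟨e.symm x, hx₁⟩ := g.extend_apply ⟨e.symm x, hx₁⟩
    rw [this]
    exact Subtype.coe_prop _
  obtain ⟨_, ⟨y, -, rfl⟩, hy⟩ := hT
  refine ⟨y, y.2, ?_⟩
  have h1 := LinearMap.toMatrix_mulVec_repr b.toBasis b.toBasis T.symm.toLinearMap (T (e.symm x))
  have h2 : ∀ z : EuclideanSpace ℂ ι, ⇑(b.toBasis.repr z) = e z := fun z => by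
    ext i; simp [b, e]
  rw [h2, h2] at h1
  rw [Matrix.mulVecLin_apply]
  convert h1 using 2
  · rw [← hy]; simp
  · simp

theorem iSup_rotated {V Q : Type*} [Fintype Q] [DecidableEq Q] {N : V → Finset Q} {d : Q → ℕ} (W : ∀ i, Submodule ℂ (QuditSpace d (N i)))
    (U : ∀ i, Matrix.unitaryGroup (Config d (N i)) ℂ) :
    ⨆ i, rotated N d W U i =
      ⨆ i, extendQudits d (N i) ((W i).map (Matrix.mulVecLin (U i : Matrix _ _ ℂ))) :=
  iSup_congr fun i => tensorRest_eq_extendLocal d (N i) _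

variable {V Q : Type*} {N : V → Finset Q} {d : Q → ℕ}

/-- The matrices of a family act on vectors. -/
noncomputable def matrixFamilyToLin {V : Type*} (ι : V → Type*) [∀ i, Fintype (ι i)] :
    (∀ i, Matrix (ι i) (ι i) ℂ) →ₗ[ℂ] ∀ i, (ι i → ℂ) →ₗ[ℂ] (ι i → ℂ) where
  toFun M i := Matrix.mulVecLin (M i)
  map_add' M M' := funext fun i => Matrix.mulVecLin_add _ _
  map_smul' c M := funext fun i => by ext; simp

theorem ae_finrank_range_le {V : Type*} [Fintype V] {ι : V → Type*} [∀ i, Fintype (ι i)]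
    [∀ i, DecidableEq (ι i)] {F H : Type*} [AddCommGroup F] [Module ℂ F] [AddCommGroup H]
    [Module ℂ H] [FiniteDimensional ℂ H]
    (A : (∀ i, Matrix (ι i) (ι i) ℂ) →ₗ[ℂ] F →ₗ[ℂ] H) (U₀ : ∀ i, Matrix.unitaryGroup (ι i) ℂ) :
    ∀ᵐ U : (∀ i, Matrix.unitaryGroup (ι i) ℂ) ∂(Measure.pi fun i => unitaryHaar (ι i)),
      finrank ℂ (LinearMap.range (A fun i => (U₀ i : Matrix (ι i) (ι i) ℂ))) ≤
        finrank ℂ (LinearMap.range (A fun i => (U i : Matrix (ι i) (ι i) ℂ))) := by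
  generalize hk : finrank ℂ (LinearMap.range (A fun i => (U₀ i : Matrix (ι i) (ι i) ℂ))) = k
  obtain ⟨φ, ψ, hφψ⟩ := exists_det_ne_zero_of_le_finrank_range
    (A fun i => (U₀ i : Matrix (ι i) (ι i) ℂ)) hk.ge
  let B : (∀ i, Matrix (ι i) (ι i) ℂ) →ₗ[ℂ] Matrix (Fin k) (Fin k) ℂ :=
    LinearMap.toMatrix'.toLinearMap ∘ₗ LinearMap.compRight ℂ ψ ∘ₗ LinearMap.lcomp ℂ H φ ∘ₗ A
  have hB : ∀ M, B M = LinearMap.toMatrix' (ψ ∘ₗ A M ∘ₗ φ) := fun M => rfl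
  filter_upwards [ae_unitary_det_ne_zero B U₀ (by rwa [hB])] with U hU
  rw [hB] at hU
  exact le_finrank_range_of_det_ne_zero _ φ ψ hU

/-- Suitable unitaries rotate the `W i` over the good subspaces, and the rank of the sum at these
unitaries is almost surely not undercut. -/
theorem Achieves.ae [Fintype V] [Fintype Q] [DecidableEq Q]
    {r : V → ℚ} {c : ℚ} (h : Achieves N d r c)
    {W : ∀ i, Submodule ℂ (QuditSpace d (N i))} (hW : ∀ i, relDim (W i) = r i) :
    ∀ᵐ U ∂(Measure.pi fun i => unitaryHaar (Config d (N i))),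
      c ≤ relDim (⨆ i, rotated N d W U i) := by
  obtain ⟨L, hL, hLc⟩ := h
  choose U₀ hU₀ using fun i => exists_unitary_le_map
    (relDim_le_relDim_iff.1 ((hL i).trans_eq (hW i).symm))
  have hrange : ∀ U : ∀ i, Matrix.unitaryGroup (Config d (N i)) ℂ,
      LinearMap.range ((localSumMap (α := fun j => Fin (d j)) N W ∘ₗ matrixFamilyToLin _)
        fun i => (U i : Matrix _ _ ℂ)) = ⨆ i, rotated N d W U i := fun U => by
    rw [LinearMap.comp_apply, range_localSumMap, iSup_rotated]
    rfl
  filter_upwards [ae_finrank_range_le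
    (localSumMap (α := fun j => Fin (d j)) N W ∘ₗ matrixFamilyToLin _) U₀] with U h1
  rw [hrange, hrange, ← relDim_le_relDim_iff] at h1
  refine (hLc.trans (relDim_mono ?_)).trans h1
  rw [iSup_rotated]
  exact iSup_mono fun i => extendLocal_mono (hU₀ i)

theorem exists_relDim_eq [DecidableEq Q] {r : V → ℚ} (hr : ∀ i, 0 < r i ∧ r i ≤ 1)
    (hd : ∀ i, ∃ j ∈ N i, (r i).den ∣ d j) (hd0 : ∀ j, 0 < d j) :
    ∃ W : ∀ i, Submodule ℂ (QuditSpace d (N i)), ∀ i, relDim (W i) = r i := by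
  suffices h : ∀ i, ∃ W : Submodule ℂ (QuditSpace d (N i)), relDim W = r i by
    choose W hW using h
    exact ⟨W, hW⟩
  intro i
  set n := finrank ℂ (QuditSpace d (N i)) with hn
  have hn' : n = ∏ j : N i, d j := by
    rw [hn, finrank_fintype_fun_eq_card, Fintype.card_pi]
    simp
  have hn0 : 0 < n := hn' ▸ Finset.prod_pos fun j _ => hd0 j
  obtain ⟨j, hj, hdvd⟩ := hd i
  obtain ⟨q, hq⟩ : (r i).den ∣ n :=
    hdvd.trans (hn' ▸ Finset.dvd_prod_of_mem (fun j : N i => d j) (Finset.mem_univ ⟨j, hj⟩))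
  have hnum : ((r i).num.toNat : ℚ) = (r i).num := by
    have h1 : ((r i).num.toNat : ℤ) = (r i).num :=
      Int.toNat_of_nonneg (Rat.num_nonneg.2 (hr i).1.le)
    exact_mod_cast h1
  have hmul : (((r i).num.toNat * q : ℕ) : ℚ) = r i * n := by
    rw [hq, Nat.cast_mul, Nat.cast_mul, hnum, ← mul_assoc, Rat.mul_den_eq_num]
  have hle : (r i).num.toNat * q ≤ n := by
    have : (((r i).num.toNat * q : ℕ) : ℚ) ≤ n := by
      rw [hmul]; exact mul_le_of_le_one_left (Nat.cast_nonneg n) (hr i).2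
    exact_mod_cast this
  obtain ⟨W, hW⟩ := exists_submodule_finrank_eq (hn ▸ hle)
  refine ⟨W, ?_⟩
  have hnq : (n : ℚ) ≠ 0 := Nat.cast_ne_zero.2 hn0.ne'
  rw [relDim, hW, hmul, ← hn, mul_div_cancel_right₀ _ hnq]

/-- Enlarging every qudit by the product of the denominators makes the prescribed relative
dimensions attainable, since each neighbourhood is nonempty. -/
theorem exists_dims_of_achieves [Fintype V] [Fintype Q] [DecidableEq Q]
    (hN : ∀ i, (N i).Nonempty) {r : V → ℚ}
    (hr : ∀ i, 0 < r i ∧ r i ≤ 1) (hd : ∀ k, 0 < d k) {c : ℚ} (h : Achieves N d r c) :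
    (∃ W : ∀ i, Submodule ℂ (QuditSpace (fun k => (∏ i, (r i).den) * d k) (N i)),
      ∀ i, relDim (W i) = r i) ∧
    Achieves N (fun k => (∏ i, (r i).den) * d k) r c := by
  have hD : 0 < ∏ i, (r i).den := Finset.prod_pos fun i _ => (r i).den_pos
  refine ⟨exists_relDim_eq hr (fun i => ?_) fun j => Nat.mul_pos hD (hd j),
    h.enlarge (e := fun _ => ∏ i, (r i).den) fun _ => hD⟩
  obtain ⟨j, hj⟩ := hN i
  exact ⟨j, hj, (Finset.dvd_prod_of_mem _ (Finset.mem_univ i)).mul_right _⟩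

end Random

/-! ### Assembly of the equivalence and of the two dimension bounds -/

theorem mainTheorem2 (m n : ℕ) (N : Fin m → Finset (Fin n)) (hN : ∀ i, (N i).Nonempty)
    (r : Fin m → ℚ) (hr : ∀ i, 0 < r i ∧ r i ≤ 1) :
    ((fun i => (r i : ℝ)) ∈ abstractInterior (depGraph N) ↔ ¬ BeyondShearer (depGraph N) r) ∧
    ((fun i => (r i : ℝ)) ∉ abstractInterior (depGraph N) →
      ∃ d : Fin n → ℕ, (∀ j, 0 < d j ∧ d j ≤ ∏ i, (r i).den ^ (2 ^ (2 * m))) ∧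
        AlmostSurelyForRandomInstance N r d (fun S => relDim (⨆ i, S i) = 1)) ∧
    ((fun i => (r i : ℝ)) ∈ abstractInterior (depGraph N) →
      ∃ d : Fin n → ℕ, (∀ j, 0 < d j ∧ d j ≤ ∏ i, (r i).den ^ (2 ^ (2 * m + 3))) ∧
        AlmostSurelyForRandomInstance N r d
          (fun S => relDim (⨆ i, S i) = 1 - indepPoly (depGraph N) r)) := by
  have hr0 : ∀ i, 0 ≤ r i := fun i => (hr i).1.le
  have hiff : (fun i => (r i : ℝ)) ∈ abstractInterior (depGraph N) ↔
      ∀ T, 0 < indepPolyOn (depGraph N) r T := by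
    rw [mem_abstractInterior_iff fun i => ⟨by exact_mod_cast hr0 i, by exact_mod_cast (hr i).2⟩]
    refine forall_congr' fun T => ?_
    have h := map_indepPolyOn (Rat.castHom ℝ) (depGraph N) r T
    simp only [eq_ratCast] at h
    rw [← h, Rat.cast_pos]
  have hD : 0 < ∏ i, (r i).den := Finset.prod_pos fun i _ => (r i).den_pos
  -- The extra factor for integrality is paid for by the -1 in the exponents 4^k - 1 of the
  -- constructions.
  have hbound : ∀ {a b x : ℕ}, x ≤ (∏ i, (r i).den) ^ a → a + 1 ≤ b →
      (∏ i, (r i).den) * x ≤ ∏ i, (r i).den ^ b := by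
    intro a b x hx hab
    rw [Finset.prod_pow]
    calc (∏ i, (r i).den) * x ≤ (∏ i, (r i).den) * (∏ i, (r i).den) ^ a :=
          Nat.mul_le_mul_left _ hx
      _ = (∏ i, (r i).den) ^ (a + 1) := by rw [pow_succ, mul_comm]
      _ ≤ _ := Nat.pow_le_pow_right hD hab
  have h4 : ∀ k, 1 ≤ 4 ^ k := fun k => Nat.one_le_pow _ _ (by norm_num)
  refine ⟨hiff.trans (not_beyondShearer_iff (depGraph N) r).symm, fun hmem => ?_, fun hmem => ?_⟩
  · rw [hiff] at hmem
    push Not at hmem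
    obtain ⟨T, hT⟩ := hmem
    obtain ⟨S, -, hS, hmin⟩ := exists_minimal_indepPolyOn_nonpos (depGraph N) r hT
    obtain ⟨d, hd, hach⟩ := achieves_one hr0 hmin hS
    have hach' : Achieves N d r 1 := hach.mono (fun i => by
      simp only [restrictTo]; split_ifs; exacts [le_rfl, hr0 i]) le_rfl
    obtain ⟨hW, hach''⟩ := exists_dims_of_achieves hN hr (fun k => (hd k).1) hach'
    refine ⟨_, fun j => ⟨Nat.mul_pos hD (hd j).1, ?_⟩, hW, fun W hW => ?_⟩
    · refine hbound (a := 4 ^ (S.card - 1) - 1) ((hd j).2.trans (Nat.pow_le_pow_left ?_ _)) ?_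
      · exact Finset.prod_le_prod_of_subset_of_one_le' (Finset.subset_univ S)
          fun i _ _ => (r i).den_pos
      · rw [Nat.sub_add_cancel (h4 _), pow_mul]
        refine Nat.pow_le_pow_right (by norm_num) ?_
        have := Finset.card_le_univ S
        rw [Fintype.card_fin] at this
        omega
    · filter_upwards [hach''.ae hW] with U hU
      exact le_antisymm (relDim_le_one _) hU
  · rw [hiff] at hmem
    obtain ⟨d, hd, hach⟩ := achieves_one_sub hN Finset.univ hr0 fun A _ => hmem A
    have hach' : Achieves N d r (1 - indepPolyOn (depGraph N) r Finset.univ) :=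
      hach.mono (fun i => by simp [restrictTo]) le_rfl
    obtain ⟨hW, hach''⟩ := exists_dims_of_achieves hN hr (fun k => (hd k).1) hach'
    refine ⟨_, fun j => ⟨Nat.mul_pos hD (hd j).1, ?_⟩, hW, fun W hW => ?_⟩
    · refine hbound (hd j).2 ?_
      rw [Nat.sub_add_cancel (h4 _), Finset.card_fin, pow_add, pow_mul]
      exact Nat.le_mul_of_pos_right _ (by norm_num)
    · filter_upwards [hach''.ae hW] with U hU
      rw [indepPoly_eq_indepPolyOn]
      refine le_antisymm ?_ hU
      rw [iSup_rotated]
      -- The upper bound holds for every choice of unitaries, so equality is almost sure.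
      refine relDim_iSup_le_one_sub (fun k => Nat.mul_pos hD (hd k).1) hr0 hmem fun i => ?_
      rw [← hW i, relDim_le_relDim_iff]
      exact Submodule.finrank_map_le _ _
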